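/- **Setting.** Let $X\in\mathbb R^{n\times d_x}$, $Y\in\mathbb R^{n\times d_y}$, $\lambda_x,\lambda_y\ge 0$, and put $\Sigma_{xx}=X^{T}X+\lambda_x I_{d_x}$, $\Sigma_{yy}=Y^{T}Y+\lambda_y I_{d_y}$, $\Sigma_{xy}=X^{T}Y$, $\Sigma=\operatorname{blockdiag}(\Sigma_{xx},\Sigma_{yy})$, $q=\min(\operatorname{rank}\Sigma_{xx},\operatorname{rank}\Sigma_{yy})$. The canonical correlations $\sigma_1\ge\dots\ge\sigma_q$ are the numbers that arise by maximizing $\operatorname{Tr}(U^{T}\Sigma_{xy}V)$ over $U\in\mathbb R^{d_x\times q}$, $V\in\mathbb R^{d_y\times q}$ and $\sigma_1\ge\dots\ge\sigma_q$ subject to $U^{T}\Sigma_{xx}U=I_q$, $V^{T}\Sigma_{yy}V=I_q$, $U^{T}\Sigma_{xy}V=\operatorname{diag}(\sigma_1,\dots,\sigma_q)$. Let $1\le p\le q$, $\mu_1>\dots>\mu_p>0$, $N=\operatorname{diag}(\mu_1,\dots,\mu_p)$. On $$\mathbb S_{xy}=\Big\{Z=\begin{bmatrix}U\\V\end{bmatrix}\in\mathbb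 R^{(d_x+d_y)\times p}:\ U^{T}\Sigma_{xx}U=I_p,\ V^{T}\Sigma_{yy}V=I_p\Big\}$$ consider $$f_{\rm CCA}(Z)=-\tfrac12\operatorname{Tr}\Big(Z^{T}\begin{bmatrix}0&\Sigma_{xy}\\ \Sigma_{xy}^{T}&0\end{bmatrix}ZN\Big),$$ and let $\mathbb S_{xy}$ carry the Riemannian metric $\langle\xi,\eta\rangle=\operatorname{Tr}(\xi^{T}M\eta)$, where $M=\operatorname{blockdiag}(M_x,M_y)$ and $M_x,M_y$ are given symmetric positive definite matrices. A critical point is a $Z\in\mathbb S_{xy}$ at which the Riemannian gradient of $f_{\rm CCA}$ vanishes; a saddle point is a critical point that is neither a local minimizer nor a local maximizer of $f_{\rm CCA}$ on $\mathbb S_{xy}$. Two points of $\mathbb S_{xy}$ are equal up to column signs if one is obtained from the other by multiplying some columns of the stacked matrix $Z$ by $-1$. For $F:\mathbb S_{xy}\to\mathbb S_{xy}$, a point $\hat Z$ is *stable* if for every neighbourhood $O$ of $\hat Z$ there is a neighbourhood $O'$ of $\hat Z$ with $F^{k}(Z)\in O$ for all $Z\in O'$, $k\ge0$; it is *asymptotically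 stable* if moreover $F^{k}(Z)\to\hat Z$ for all $Z$ in some neighbourhood of $\hat Z$; it is *unstable* if it is not stable. **Theorem.** Assume that $\Sigma$ is symmetric positive definite and that $\sigma_1,\dots,\sigma_q$ are distinct; if $p=q$, assume in addition that $d_x\ne d_y$ and $\sigma_q>0$. Then $f_{\rm CCA}$ has a global minimizer on $\mathbb S_{xy}$, and every global minimizer $Z^\star$ has the following properties. 1. $Z^\star$ is a critical point, and it is a strict local minimizer and, up to column signs, the only local minimizer: for $Z\in\mathbb S_{xy}$, $Z$ is a local minimizer $\iff$ $Z$ is a strict local minimizer $\iff$ $Z$ equals $Z^\star$ up to column signs. 2. Every critical point that is not equal to $Z^\star$ up to column signs is a saddle point or a global maximizer of $f_{\rm CCA}$ on $\mathbb S_{xy}$. 3. Let $F:\mathbb S_{xy}\to\mathbb S_{xy}$ be the map of an optimization algorithm such that $f_{\rm CCA}(F(Z))\le f_{\rm CCA}(Z)$ for all $Z$ (descent mapping), for every $Z$ all accumulation points of $(F^{k}(Z))_{k\ge0}$ are critical points, and for every local minimizer $\hat Z$ the step $F(Z)-Z$ tends to $0$ as $Z\to\hat Z$ in $\mathbb S_{xy}$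 (in particular $F(\hat Z)=\hat Z$). Then a critical point is asymptotically stable for $F$ if and only if it equals $Z^\star$ up to column signs, and all other critical points are unstable. -/

import Mathlib

open Filter Topology

noncomputable section

/-! ### Regularized canonical correlations -/

/-- The regularized Gram matrix `Aᵀ A + lam • I`. -/
def regGram {n d : ℕ} (A : Matrix (Fin n) (Fin d) ℝ) (lam : ℝ) : Matrix (Fin d) (Fin d) ℝ :=
  A.transpose * A + lam • (1 : Matrix (Fin d) (Fin d) ℝ)

/-- The generalized Stiefel manifold `{W ∈ ℝ^{d × p} : Wᵀ B W = I_p}`. -/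
def genStiefel {d : ℕ} (B : Matrix (Fin d) (Fin d) ℝ) (p : ℕ) :
    Set (Matrix (Fin d) (Fin p) ℝ) :=
  {W | W.transpose * B * W = 1}

/-- The constraints that the canonical correlations `σ 0 ≥ σ 1 ≥ …` and the canonical weights
(the columns of `U` and `V`) have to satisfy. -/
structure CanonicalFeasible {dx dy q : ℕ} (Sxx : Matrix (Fin dx) (Fin dx) ℝ)
    (Sxy : Matrix (Fin dx) (Fin dy) ℝ) (Syy : Matrix (Fin dy) (Fin dy) ℝ)
    (σ : Fin q → ℝ) (U : Matrix (Fin dx) (Fin q) ℝ) (V : Matrix (Fin dy) (Fin q) ℝ) : Prop where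
  antitone : Antitone σ
  memU : U ∈ genStiefel Sxx q
  memV : V ∈ genStiefel Syy q
  diag : U.transpose * Sxy * V = Matrix.diagonal σ

/-- `σ` is the sequence of canonical correlations: together with some weights `U`, `V` it
maximizes `Tr (Uᵀ Sxy V)` under the constraints above. -/
def IsCanonicalCorrelations {dx dy q : ℕ} (Sxx : Matrix (Fin dx) (Fin dx) ℝ)
    (Sxy : Matrix (Fin dx) (Fin dy) ℝ) (Syy : Matrix (Fin dy) (Fin dy) ℝ)
    (σ : Fin q → ℝ) : Prop :=
  ∃ (U : Matrix (Fin dx) (Fin q) ℝ) (V : Matrix (Fin dy) (Fin q) ℝ),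
    CanonicalFeasible Sxx Sxy Syy σ U V ∧
    ∀ (σ' : Fin q → ℝ) (U' : Matrix (Fin dx) (Fin q) ℝ) (V' : Matrix (Fin dy) (Fin q) ℝ),
      CanonicalFeasible Sxx Sxy Syy σ' U' V' →
        (U'.transpose * Sxy * V').trace ≤ (U.transpose * Sxy * V).trace

/-! ### The search space, its tangent spaces and the cost

A point `Z` is the vertical stack of its blocks `U = Z.toRows₁` and `V = Z.toRows₂`. -/

/-- The product of the two generalized Stiefel manifolds, as a subset of `ℝ^{(dx + dy) × p}`. -/
def prodStiefel {dx dy : ℕ} (Sxx : Matrix (Fin dx) (Fin dx) ℝ)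
    (Syy : Matrix (Fin dy) (Fin dy) ℝ) (p : ℕ) : Set (Matrix (Fin dx ⊕ Fin dy) (Fin p) ℝ) :=
  {Z | Z.toRows₁ ∈ genStiefel Sxx p ∧ Z.toRows₂ ∈ genStiefel Syy p}

/-- The tangent space of the generalized Stiefel manifold of `B` at `W`. -/
def stiefelTangent {d p : ℕ} (B : Matrix (Fin d) (Fin d) ℝ) (W : Matrix (Fin d) (Fin p) ℝ) :
    Set (Matrix (Fin d) (Fin p) ℝ) :=
  {ξ | ξ.transpose * B * W + W.transpose * B * ξ = 0}

/-- The tangent space of the product of the two generalized Stiefel manifolds at `Z`. -/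
def prodTangent {dx dy p : ℕ} (Sxx : Matrix (Fin dx) (Fin dx) ℝ)
    (Syy : Matrix (Fin dy) (Fin dy) ℝ) (Z : Matrix (Fin dx ⊕ Fin dy) (Fin p) ℝ) :
    Set (Matrix (Fin dx ⊕ Fin dy) (Fin p) ℝ) :=
  {ξ | ξ.toRows₁ ∈ stiefelTangent Sxx Z.toRows₁ ∧ ξ.toRows₂ ∈ stiefelTangent Syy Z.toRows₂}

/-- The cost `-½ Tr (Zᵀ [0, Sxy; Sxyᵀ, 0] Z N)` with `N = diag(μ)`, on all of
`ℝ^{(dx + dy) × p}`. -/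
def ccaCost {dx dy p : ℕ} (Sxy : Matrix (Fin dx) (Fin dy) ℝ) (μ : Fin p → ℝ)
    (Z : Matrix (Fin dx ⊕ Fin dy) (Fin p) ℝ) : ℝ :=
  -(1 / 2 : ℝ) *
    (Z.transpose * Matrix.fromBlocks 0 Sxy Sxy.transpose 0 * Z * Matrix.diagonal μ).trace

/-- The Riemannian metric `⟨ξ, η⟩ = Tr (ξᵀ M η)` for the preconditioner
`M = blockdiag(Mx, My)`. -/
def precondMetric {dx dy p : ℕ} (Mx : Matrix (Fin dx) (Fin dx) ℝ)
    (My : Matrix (Fin dy) (Fin dy) ℝ) (ξ η : Matrix (Fin dx ⊕ Fin dy) (Fin p) ℝ) : ℝ :=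
  (ξ.transpose * Matrix.fromBlocks Mx 0 0 My * η).trace

/-- `G` is the Riemannian gradient at `Z` of the restriction of `f` to the product of the two
generalized Stiefel manifolds: the tangent vector that represents the differential of `f`
(a smooth function on the ambient space) on the tangent space. -/
def IsRiemannianGradient {dx dy p : ℕ} (Sxx : Matrix (Fin dx) (Fin dx) ℝ)
    (Syy : Matrix (Fin dy) (Fin dy) ℝ) (Mx : Matrix (Fin dx) (Fin dx) ℝ)
    (My : Matrix (Fin dy) (Fin dy) ℝ) (f : Matrix (Fin dx ⊕ Fin dy) (Fin p) ℝ → ℝ)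
    (Z G : Matrix (Fin dx ⊕ Fin dy) (Fin p) ℝ) : Prop :=
  G ∈ prodTangent Sxx Syy Z ∧
    ∀ ξ ∈ prodTangent Sxx Syy Z, precondMetric Mx My G ξ = lineDeriv ℝ f Z ξ

/-- A critical point: a point at which the Riemannian gradient is zero. -/
def IsRiemannianCritical {dx dy p : ℕ} (Sxx : Matrix (Fin dx) (Fin dx) ℝ)
    (Syy : Matrix (Fin dy) (Fin dy) ℝ) (Mx : Matrix (Fin dx) (Fin dx) ℝ)
    (My : Matrix (Fin dy) (Fin dy) ℝ) (f : Matrix (Fin dx ⊕ Fin dy) (Fin p) ℝ → ℝ)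
    (Z : prodStiefel Sxx Syy p) : Prop :=
  IsRiemannianGradient Sxx Syy Mx My f Z.1 0

/-- `W` arises from `Z` by changing the signs of some columns (of the stacked matrix, so that
the `j`-th columns of the two blocks change sign together). -/
def ColumnSignEquiv {m : Type*} {p : ℕ} (W Z : Matrix m (Fin p) ℝ) : Prop :=
  ∃ s : Fin p → ℝ, (∀ j, s j = 1 ∨ s j = -1) ∧ W = Z * Matrix.diagonal s

/-! ### Minimizers and stability on a topological space -/

/-- `x` is a strict local minimizer of `f`. -/
def IsStrictLocalMinimizer {α : Type*} [TopologicalSpace α] (f : α → ℝ) (x : α) : Prop :=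
  ∀ᶠ y in 𝓝[≠] x, f x < f y

/-- `x` is a stable point of the iteration `F`. -/
def IsStablePoint {α : Type*} [TopologicalSpace α] (F : α → α) (x : α) : Prop :=
  ∀ O ∈ 𝓝 x, ∃ O' ∈ 𝓝 x, ∀ y ∈ O', ∀ k : ℕ, F^[k] y ∈ O

/-- `x` is an asymptotically stable point of the iteration `F`. -/
def IsAsymptoticallyStablePoint {α : Type*} [TopologicalSpace α] (F : α → α) (x : α) : Prop :=
  IsStablePoint F x ∧ ∀ᶠ y in 𝓝 x, Tendsto (fun k : ℕ => F^[k] y) atTop (𝓝 x)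

/-- `F` is a descent mapping for `f`. -/
def IsDescentMapping {α : Type*} (f : α → ℝ) (F : α → α) : Prop :=
  ∀ x, f (F x) ≤ f x

end

/-! Read by columns, a point `Z` is a pair of families `u`, `v`, orthonormal for the forms `B`, `C`
of `Sxx`, `Syy`, and the cost is `-∑ j, μ j * A (u j) (v j)` with `A` the form of `Sxy`. The
variations used on these families are plane rotations. They are isometries of the forms, so the
curves stay in the search space, and along them the cost is an explicit expression in `cos t` and
`sin t`.

First order: rotating `u` alone and `v` alone gives two symmetry relations, and distinct positive
weights then kill all `A (u i) (v j)` with `i ≠ j`. Critical points are therefore exactly the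
families of singular pairs (`StationaryPair.singularPairs`, `isRiemannianCritical_iff`). The
canonical weights are themselves singular pairs (`singularPairs_of_diagonal_maximal`), and one of
their two families is a basis. Since the `σ k` are distinct, the singular values at a critical point
are `±σ k` for distinct indices `k` (`exists_matching`), which leaves finitely many critical values.

Second order: at a local minimizer, rotating one family towards a spare direction excludes negative
singular values. Rotating both families together, either towards an unused reference pair or between
two used ones, forces the leading pairs in their natural order (`exists_sign_of_isLocalMaxOn`). So
the local minimizers form one finite orbit of sign changes. Compactness provides a global minimizer,
and finiteness makes every point of the orbit a strict one. Negating the second block negates the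
cost, so a local maximizer is a global one.

Stability: an energy barrier around a strict local minimizer traps the orbits of a descent map, and
finiteness of the critical values gives convergence there and instability at all other critical
points. -/

/-! ### Families that are orthonormal for a bilinear form -/

section FormOrthonormal

variable {E : Type*} [NormedAddCommGroup E] [NormedSpace ℝ E]

/-- The family `u` is orthonormal for the bilinear form `B`. -/
def FormOrthonormal (B : E →L[ℝ] E →L[ℝ] ℝ) {m : ℕ} (u : Fin m → E) : Prop :=
  ∀ i j, B (u i) (u j) = if i = j then 1 else 0

/-- The rotation by the angle `t` in the plane of `e` and `e'`. -/
noncomputable def planeRotation (B : E →L[ℝ] E →L[ℝ] ℝ) (e e' : E) (t : ℝ) (x : E) : E :=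
  x + (Real.cos t - 1) • (B e x • e + B e' x • e') + Real.sin t • (B e x • e' - B e' x • e)

theorem planeRotation_zero (B : E →L[ℝ] E →L[ℝ] ℝ) (e e' x : E) :
    planeRotation B e e' 0 x = x := by
  simp [planeRotation]

theorem continuous_planeRotation (B : E →L[ℝ] E →L[ℝ] ℝ) (e e' x : E) :
    Continuous fun t => planeRotation B e e' t x := by
  unfold planeRotation
  fun_prop

/-- This is `sin² + cos² = 1`. It makes `planeRotation` a source of curves inside the set of
orthonormal families. -/
theorem form_planeRotation {B : E →L[ℝ] E →L[ℝ] ℝ} (hB : ∀ x y, B x y = B y x) {e e' : E}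
    (h1 : B e e = 1) (h2 : B e' e' = 1) (h12 : B e e' = 0) (t : ℝ) (x y : E) :
    B (planeRotation B e e' t x) (planeRotation B e e' t y) = B x y := by
  have h21 : B e' e = 0 := by rw [hB, h12]
  simp only [planeRotation, map_add, map_sub, map_smul, _root_.add_apply,
    _root_.sub_apply, _root_.smul_apply, smul_eq_mul, h1, h2, h12, h21,
    hB x e, hB x e']
  linear_combination (B e x * B e y + B e' x * B e' y) * Real.sin_sq_add_cos_sq t

theorem FormOrthonormal.planeRotation {B : E →L[ℝ] E →L[ℝ] ℝ} (hB : ∀ x y, B x y = B y x)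
    {e e' : E} (h1 : B e e = 1) (h2 : B e' e' = 1) (h12 : B e e' = 0) (t : ℝ) {m : ℕ}
    {u : Fin m → E} (hu : FormOrthonormal B u) :
    FormOrthonormal B fun j => planeRotation B e e' t (u j) := fun i j => by
  rw [form_planeRotation hB h1 h2 h12, hu i j]

theorem FormOrthonormal.smul_sign {B : E →L[ℝ] E →L[ℝ] ℝ} {m : ℕ} {u : Fin m → E}
    (hu : FormOrthonormal B u) {s : Fin m → ℝ} (hs : ∀ j, s j = 1 ∨ s j = -1) :
    FormOrthonormal B fun j => s j • u j := fun i j => by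
  simp only [map_smul, _root_.smul_apply, smul_eq_mul, hu i j]
  split_ifs with h
  · subst h
    rcases hs i with h | h <;> simp [h]
  · simp

theorem FormOrthonormal.linearIndependent {B : E →L[ℝ] E →L[ℝ] ℝ} {m : ℕ} {u : Fin m → E}
    (hu : FormOrthonormal B u) : LinearIndependent ℝ u := by
  rw [Fintype.linearIndependent_iff]
  intro c hc i
  have h := congrArg (B (u i)) hc
  simpa [hu i] using h

/-- As many orthonormal vectors as the dimension span the space. -/
theorem FormOrthonormal.eq_sum [FiniteDimensional ℝ E] {B : E →L[ℝ] E →L[ℝ] ℝ} {m : ℕ}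
    {u : Fin m → E} (hu : FormOrthonormal B u) (hm : m = Module.finrank ℝ E) (x : E) :
    x = ∑ k, B (u k) x • u k := by
  have hspan : x ∈ Submodule.span ℝ (Set.range u) := by
    rw [hu.linearIndependent.span_eq_top_of_card_eq_finrank' (by simpa using hm)]
    trivial
  obtain ⟨c, rfl⟩ := (Submodule.mem_span_range_iff_exists_fun ℝ).1 hspan
  refine Finset.sum_congr rfl fun k _ => ?_
  simp [hu k]

/-- Fewer orthonormal vectors than the dimension have a common unit normal vector. -/
theorem FormOrthonormal.exists_unit_normal [FiniteDimensional ℝ E] {B : E →L[ℝ] E →L[ℝ] ℝ}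
    (hpos : ∀ x, x ≠ 0 → 0 < B x x) {m : ℕ} (u : Fin m → E) (hm : m < Module.finrank ℝ E) :
    ∃ w, B w w = 1 ∧ ∀ j, B (u j) w = 0 := by
  let T : E →ₗ[ℝ] (Fin m → ℝ) := LinearMap.pi fun j => (B (u j)).toLinearMap
  have hker : LinearMap.ker T ≠ ⊥ := LinearMap.ker_ne_bot_of_finrank_lt (by simpa using hm)
  obtain ⟨w, hw, hw0⟩ := Submodule.exists_mem_ne_zero_of_ne_bot hker
  have hw' : ∀ j, B (u j) w = 0 := fun j => congrFun (LinearMap.mem_ker.1 hw) j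
  have hs : 0 < Real.sqrt (B w w) := Real.sqrt_pos.2 (hpos w hw0)
  refine ⟨(Real.sqrt (B w w))⁻¹ • w, ?_, fun j => by simp [hw' j]⟩
  have h2 := Real.mul_self_sqrt (hpos w hw0).le
  simp only [map_smul, _root_.smul_apply, smul_eq_mul]
  rw [← h2]
  field_simp
  simp [Real.sqrt_sq hs.le]

theorem isClosed_setOf_formOrthonormal (B : E →L[ℝ] E →L[ℝ] ℝ) (m : ℕ) :
    IsClosed {u : Fin m → E | FormOrthonormal B u} := by
  simp only [FormOrthonormal, Set.ofPred_forall]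
  refine isClosed_iInter fun i => isClosed_iInter fun j => isClosed_eq ?_ continuous_const
  fun_prop

/-- By compactness of the unit sphere `B x x ≥ c * ‖x‖²` for some `c > 0`, so a `B`-unit vector has
norm at most `√(c⁻¹)`. -/
theorem isCompact_setOf_formOrthonormal [FiniteDimensional ℝ E] {B : E →L[ℝ] E →L[ℝ] ℝ}
    (hpos : ∀ x, x ≠ 0 → 0 < B x x) (m : ℕ) :
    IsCompact {u : Fin m → E | FormOrthonormal B u} := by
  have : ProperSpace E := FiniteDimensional.proper ℝ E
  obtain ⟨c, hc, hcB⟩ : ∃ c : ℝ, 0 < c ∧ ∀ x ∈ Metric.sphere (0 : E) 1, c ≤ B x x := by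
    rcases (Metric.sphere (0 : E) 1).eq_empty_or_nonempty with h | h
    -- In the zero space the sphere is empty and any positive constant serves.
    · exact ⟨1, one_pos, by simp [h]⟩
    · obtain ⟨x, hx, hmin⟩ := (isCompact_sphere (0 : E) 1).exists_isMinOn h
        (f := fun x => B x x) (by fun_prop)
      refine ⟨B x x, hpos x ?_, fun y hy => hmin hy⟩
      rintro rfl
      simp at hx
  refine Metric.isCompact_of_isClosed_isBounded (isClosed_setOf_formOrthonormal B m) ?_
  refine (Metric.isBounded_closedBall (x := (0 : Fin m → E))
    (r := Real.sqrt c⁻¹)).subset fun u hu => ?_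
  rw [mem_closedBall_zero_iff, pi_norm_le_iff_of_nonneg (Real.sqrt_nonneg _)]
  intro j
  rcases eq_or_ne (u j) 0 with h0 | h0
  · simp [h0]
  have hn : 0 < ‖u j‖ := norm_pos_iff.2 h0
  have h1 := hcB (‖u j‖⁻¹ • u j) (by simp [norm_smul, hn.ne'])
  have h2 : B (u j) (u j) = 1 := by simp [hu j j]
  simp only [map_smul, _root_.smul_apply, smul_eq_mul, h2, mul_one] at h1
  refine Real.le_sqrt_of_sq_le ?_
  rw [le_inv_comm₀ (by positivity) hc, sq, mul_inv]
  exact h1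

end FormOrthonormal

/-! ### Maximizers of linear functionals on the orthonormal families -/

section LinearFunctional

/-- If `α (cos t - 1) + β sin t ≤ 0` near `0`, then `α ≥ 0` and `β = 0`. -/
theorem trig_coeff_of_eventually_le {α β : ℝ}
    (h : ∀ᶠ t in 𝓝 (0 : ℝ), α * (Real.cos t - 1) + β * Real.sin t ≤ 0) : 0 ≤ α ∧ β = 0 := by
  have hβ : β = 0 := by
    have hmax : IsLocalMax (fun t => α * (Real.cos t - 1) + β * Real.sin t) 0 := by
      filter_upwards [h] with t ht
      simpa using ht
    have hd : HasDerivAt (fun t => α * (Real.cos t - 1) + β * Real.sin t)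
        (α * (-Real.sin 0) + β * Real.cos 0) 0 :=
      (((Real.hasDerivAt_cos 0).sub_const 1).const_mul α).add
        ((Real.hasDerivAt_sin 0).const_mul β)
    simpa using hmax.hasDerivAt_eq_zero hd
  refine ⟨?_, hβ⟩
  obtain ⟨t, ht, ht1, htπ⟩ : ∃ t : ℝ, α * (Real.cos t - 1) + β * Real.sin t ≤ 0 ∧ 0 < t ∧
      t < Real.pi := by
    have h1 : ∀ᶠ t in 𝓝[>] (0 : ℝ), α * (Real.cos t - 1) + β * Real.sin t ≤ 0 :=
      h.filter_mono nhdsWithin_le_nhds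
    have h2 : ∀ᶠ t in 𝓝[>] (0 : ℝ), t ∈ Set.Ioo 0 Real.pi := Ioo_mem_nhdsGT Real.pi_pos
    obtain ⟨t, h3, h4⟩ := (h1.and h2).exists
    exact ⟨t, h3, h4.1, h4.2⟩
  have hc : Real.cos t < 1 := by
    have := Real.cos_lt_cos_of_nonneg_of_le_pi le_rfl htπ.le ht1
    simpa using this
  subst hβ
  nlinarith

/-- If `α sin² t ≤ 0` near `0`, then `α ≤ 0`. -/
theorem sin_sq_coeff_of_eventually_le {α : ℝ}
    (h : ∀ᶠ t in 𝓝 (0 : ℝ), α * Real.sin t ^ 2 ≤ 0) : α ≤ 0 := by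
  have h1 : ∀ᶠ t in 𝓝[>] (0 : ℝ), α * Real.sin t ^ 2 ≤ 0 := h.filter_mono nhdsWithin_le_nhds
  have h2 : ∀ᶠ t in 𝓝[>] (0 : ℝ), t ∈ Set.Ioo 0 Real.pi := Ioo_mem_nhdsGT Real.pi_pos
  obtain ⟨t, h3, h4⟩ := (h1.and h2).exists
  have := Real.sin_pos_of_mem_Ioo h4
  by_contra hα
  have : 0 < α * Real.sin t ^ 2 := mul_pos (not_le.1 hα) (by positivity)
  linarith

variable {E : Type*} [NormedAddCommGroup E] [NormedSpace ℝ E]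

/-- The derivatives of `u' ↦ ∑ l, L l (u' l)` along all plane rotations of `u` vanish. -/
def RotationStationary (B : E →L[ℝ] E →L[ℝ] ℝ) {m : ℕ} (L : Fin m → E →L[ℝ] ℝ)
    (u : Fin m → E) : Prop :=
  ∀ e e', B e e = 1 → B e' e' = 1 → B e e' = 0 →
    ∑ l, (B e (u l) * L l e' - B e' (u l) * L l e) = 0

theorem apply_planeRotation (B : E →L[ℝ] E →L[ℝ] ℝ) (L : E →L[ℝ] ℝ) (e e' x : E) (t : ℝ) :
    L (planeRotation B e e' t x) = L x + (B e x * L e + B e' x * L e') * (Real.cos t - 1) +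
      (B e x * L e' - B e' x * L e) * Real.sin t := by
  simp only [planeRotation, map_add, map_sub, map_smul, smul_eq_mul]
  ring

/-- Along the rotation curve the functional is its value at `u` plus `α (cos t - 1) + β sin t`; the
two claims concern `α` and `β`. -/
theorem rotation_coeff_of_isLocalMaxOn {B : E →L[ℝ] E →L[ℝ] ℝ} (hB : ∀ x y, B x y = B y x)
    {m : ℕ} {L : Fin m → E →L[ℝ] ℝ} {u : Fin m → E} (hu : FormOrthonormal B u)
    (hmax : IsLocalMaxOn (fun u' : Fin m → E => ∑ l, L l (u' l)) {u' | FormOrthonormal B u'} u)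
    {e e' : E} (h1 : B e e = 1) (h2 : B e' e' = 1) (h12 : B e e' = 0) :
    0 ≤ ∑ l, (B e (u l) * L l e + B e' (u l) * L l e') ∧
      ∑ l, (B e (u l) * L l e' - B e' (u l) * L l e) = 0 := by
  apply trig_coeff_of_eventually_le
  have htend : Tendsto (fun t j => planeRotation B e e' t (u j)) (𝓝 0)
      (𝓝[{u' | FormOrthonormal B u'}] u) := by
    refine tendsto_nhdsWithin_iff.2 ⟨?_, .of_forall fun t => hu.planeRotation hB h1 h2 h12 t⟩
    have hc : Continuous fun t j => planeRotation B e e' t (u j) :=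
      continuous_pi fun j => continuous_planeRotation B e e' (u j)
    simpa [planeRotation_zero] using hc.tendsto 0
  filter_upwards [htend.eventually hmax] with t ht
  simp only [apply_planeRotation, Finset.sum_add_distrib, ← Finset.sum_mul] at ht
  simp only [Finset.sum_add_distrib] at *
  linarith

theorem RotationStationary.of_isLocalMaxOn {B : E →L[ℝ] E →L[ℝ] ℝ} (hB : ∀ x y, B x y = B y x)
    {m : ℕ} {L : Fin m → E →L[ℝ] ℝ} {u : Fin m → E} (hu : FormOrthonormal B u)
    (hmax : IsLocalMaxOn (fun u' : Fin m → E => ∑ l, L l (u' l))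
      {u' | FormOrthonormal B u'} u) : RotationStationary B L u := fun _ _ h1 h2 h12 =>
  (rotation_coeff_of_isLocalMaxOn hB hu hmax h1 h2 h12).2

/-- Rotation in the plane of `u i` and `u j` moves only these two vectors, and its derivative is the
difference of the two sides. -/
theorem RotationStationary.symm {B : E →L[ℝ] E →L[ℝ] ℝ}
    {m : ℕ} {L : Fin m → E →L[ℝ] ℝ} {u : Fin m → E} (hu : FormOrthonormal B u)
    (h : RotationStationary B L u) (i j : Fin m) : L i (u j) = L j (u i) := by
  rcases eq_or_ne i j with rfl | hij
  · rfl
  have := h (u i) (u j) (by simp [hu i i]) (by simp [hu j j]) (by simp [hu i j, hij])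
  simp only [hu _ _, ite_mul, one_mul, zero_mul, Finset.sum_sub_distrib, Finset.sum_ite_eq,
    Finset.mem_univ, if_true] at this
  linarith

/-- Rotation of `u j` towards the normalized `w` fixes all other members of the family, so its
derivative is a multiple of `L j w`. -/
theorem RotationStationary.apply_normal {B : E →L[ℝ] E →L[ℝ] ℝ} (hB : ∀ x y, B x y = B y x)
    (hpos : ∀ x, x ≠ 0 → 0 < B x x)
    {m : ℕ} {L : Fin m → E →L[ℝ] ℝ} {u : Fin m → E} (hu : FormOrthonormal B u)
    (h : RotationStationary B L u) {w : E} (hw : ∀ i, B (u i) w = 0) (j : Fin m) :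
    L j w = 0 := by
  rcases eq_or_ne w 0 with rfl | hw0
  · simp
  have hs : 0 < Real.sqrt (B w w) := Real.sqrt_pos.2 (hpos w hw0)
  have h2 := Real.mul_self_sqrt (hpos w hw0).le
  have h3 : ∀ x, B w (u x) = 0 := fun x => by rw [hB, hw]
  have := h (u j) ((Real.sqrt (B w w))⁻¹ • w) (by simp [hu j j]) (by
    simp only [map_smul, _root_.smul_apply, smul_eq_mul]
    rw [← h2]
    field_simp
    simp [Real.sqrt_sq hs.le]) (by simp [hw])
  simp only [hu _ _, ite_mul, one_mul, zero_mul, Finset.sum_ite_eq,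
    Finset.mem_univ, if_true, map_smul, _root_.smul_apply, smul_eq_mul, h3,
    mul_zero, sub_zero, mul_eq_zero, inv_eq_zero] at this
  exact this.resolve_left hs.ne'

/-- At a stationary family the functionals are combinations of the forms `B (u i)`. -/
theorem RotationStationary.apply_eq_sum {B : E →L[ℝ] E →L[ℝ] ℝ} (hB : ∀ x y, B x y = B y x)
    (hpos : ∀ x, x ≠ 0 → 0 < B x x)
    {m : ℕ} {L : Fin m → E →L[ℝ] ℝ} {u : Fin m → E} (hu : FormOrthonormal B u)
    (h : RotationStationary B L u) (j : Fin m) (x : E) :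
    L j x = ∑ i, B (u i) x * L j (u i) := by
  have := h.apply_normal hB hpos hu (w := x - ∑ i, B (u i) x • u i)
    (fun i => by simp [hu i]) j
  rw [map_sub, sub_eq_zero] at this
  simpa using this

/-- When `u j` is rotated towards a unit normal of the family, the cosine coefficient is `L j (u
j)`. Such a normal exists because the family does not fill the space. -/
theorem apply_nonneg_of_isLocalMaxOn [FiniteDimensional ℝ E] {B : E →L[ℝ] E →L[ℝ] ℝ}
    (hB : ∀ x y, B x y = B y x) (hpos : ∀ x, x ≠ 0 → 0 < B x x)
    {m : ℕ} {L : Fin m → E →L[ℝ] ℝ} {u : Fin m → E} (hu : FormOrthonormal B u)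
    (hmax : IsLocalMaxOn (fun u' : Fin m → E => ∑ l, L l (u' l)) {u' | FormOrthonormal B u'} u)
    (hm : m < Module.finrank ℝ E) (j : Fin m) : 0 ≤ L j (u j) := by
  obtain ⟨w, hw1, hw⟩ := FormOrthonormal.exists_unit_normal hpos u hm
  have h3 : ∀ x, B w (u x) = 0 := fun x => by rw [hB, hw]
  have := (rotation_coeff_of_isLocalMaxOn hB hu hmax (e := u j) (e' := w) (by simp [hu j j])
    hw1 (hw j)).1
  simpa [hu _ _, h3] using this

end LinearFunctional

/-! ### Pairs of orthonormal families and the weighted sum of a bilinear form -/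

section Pairs

variable {E F : Type*} [NormedAddCommGroup E] [NormedSpace ℝ E]
  [NormedAddCommGroup F] [NormedSpace ℝ F]

/-- The pairs of a `B`-orthonormal and a `C`-orthonormal family of length `m`. -/
def orthonormalPairs (B : E →L[ℝ] E →L[ℝ] ℝ) (C : F →L[ℝ] F →L[ℝ] ℝ) (m : ℕ) :
    Set ((Fin m → E) × (Fin m → F)) :=
  {w | FormOrthonormal B w.1 ∧ FormOrthonormal C w.2}

/-- The weighted sum `∑ j, μ j * A (u j) (v j)`. -/
noncomputable def pairSum (A : E →L[ℝ] F →L[ℝ] ℝ) {m : ℕ} (μ : Fin m → ℝ)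
    (w : (Fin m → E) × (Fin m → F)) : ℝ :=
  ∑ j, μ j * A (w.1 j) (w.2 j)

/-- The derivatives of `pairSum A μ` at `(u, v)` along the plane rotations of `u` and of `v`
vanish. -/
def StationaryPair (B : E →L[ℝ] E →L[ℝ] ℝ) (C : F →L[ℝ] F →L[ℝ] ℝ) (A : E →L[ℝ] F →L[ℝ] ℝ)
    {m : ℕ} (μ : Fin m → ℝ) (u : Fin m → E) (v : Fin m → F) : Prop :=
  RotationStationary B (fun l => μ l • A.flip (v l)) u ∧
    RotationStationary C (fun l => μ l • A (u l)) v

/-- Each `(u j, v j)` is a pair of singular vectors of `A` for the singular value `θ j`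
(of arbitrary sign). -/
def SingularPairs (B : E →L[ℝ] E →L[ℝ] ℝ) (C : F →L[ℝ] F →L[ℝ] ℝ) (A : E →L[ℝ] F →L[ℝ] ℝ)
    {m : ℕ} (θ : Fin m → ℝ) (u : Fin m → E) (v : Fin m → F) : Prop :=
  (∀ j x, A x (v j) = θ j * B (u j) x) ∧ ∀ j y, A (u j) y = θ j * C (v j) y

theorem continuous_pairSum (A : E →L[ℝ] F →L[ℝ] ℝ) {m : ℕ} (μ : Fin m → ℝ) :
    Continuous (pairSum A μ) := by
  unfold pairSum
  fun_prop

variable {B : E →L[ℝ] E →L[ℝ] ℝ} {C : F →L[ℝ] F →L[ℝ] ℝ} {A : E →L[ℝ] F →L[ℝ] ℝ}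
  {m : ℕ} {μ : Fin m → ℝ} {u : Fin m → E} {v : Fin m → F}

theorem isLocalMaxOn_left_of_pair (hv : FormOrthonormal C v)
    (h : IsLocalMaxOn (pairSum A μ) (orthonormalPairs B C m) (u, v)) :
    IsLocalMaxOn (fun u' : Fin m → E => ∑ l, (μ l • A.flip (v l)) (u' l))
      {u' | FormOrthonormal B u'} u := by
  have ht : Tendsto (fun u' : Fin m → E => (u', v)) (𝓝[{u' | FormOrthonormal B u'}] u)
      (𝓝[orthonormalPairs B C m] (u, v)) := by
    refine tendsto_nhdsWithin_iff.2 ⟨?_, eventually_nhdsWithin_of_forall fun u' hu' => ⟨hu', hv⟩⟩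
    exact ((continuous_id.prodMk continuous_const).tendsto u).mono_left nhdsWithin_le_nhds
  simpa [IsLocalMaxOn, IsMaxFilter, pairSum] using ht.eventually h

theorem isLocalMaxOn_right_of_pair (hu : FormOrthonormal B u)
    (h : IsLocalMaxOn (pairSum A μ) (orthonormalPairs B C m) (u, v)) :
    IsLocalMaxOn (fun v' : Fin m → F => ∑ l, (μ l • A (u l)) (v' l))
      {v' | FormOrthonormal C v'} v := by
  have ht : Tendsto (fun v' : Fin m → F => (u, v')) (𝓝[{v' | FormOrthonormal C v'}] v)
      (𝓝[orthonormalPairs B C m] (u, v)) := by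
    refine tendsto_nhdsWithin_iff.2 ⟨?_, eventually_nhdsWithin_of_forall fun v' hv' => ⟨hu, hv'⟩⟩
    exact ((continuous_const.prodMk continuous_id).tendsto v).mono_left nhdsWithin_le_nhds
  simpa [IsLocalMaxOn, IsMaxFilter, pairSum] using ht.eventually h

theorem StationaryPair.of_isLocalMaxOn (hB : ∀ x y, B x y = B y x) (hC : ∀ x y, C x y = C y x)
    (hu : FormOrthonormal B u) (hv : FormOrthonormal C v)
    (h : IsLocalMaxOn (pairSum A μ) (orthonormalPairs B C m) (u, v)) :
    StationaryPair B C A μ u v :=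
  ⟨.of_isLocalMaxOn hB hu (isLocalMaxOn_left_of_pair hv h),
    .of_isLocalMaxOn hC hv (isLocalMaxOn_right_of_pair hu h)⟩

/-- Multiplied by `μ j`, this is the expansion of a stationary functional in the forms `B (u i)`;
the nonzero weight is cancelled. -/
theorem StationaryPair.left_eq_sum (hB : ∀ x y, B x y = B y x) (hBpos : ∀ x, x ≠ 0 → 0 < B x x)
    (hu : FormOrthonormal B u) (h : StationaryPair B C A μ u v) (hμ : ∀ j, μ j ≠ 0)
    (j : Fin m) (x : E) : A x (v j) = ∑ i, B (u i) x * A (u i) (v j) := by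
  have := h.1.apply_eq_sum hB hBpos hu j x
  simp only [_root_.smul_apply, ContinuousLinearMap.flip_apply, smul_eq_mul] at this
  apply mul_left_cancel₀ (hμ j)
  rw [this, Finset.mul_sum]
  exact Finset.sum_congr rfl fun i _ => by ring

theorem StationaryPair.right_eq_sum (hC : ∀ x y, C x y = C y x)
    (hCpos : ∀ x, x ≠ 0 → 0 < C x x)
    (hv : FormOrthonormal C v) (h : StationaryPair B C A μ u v) (hμ : ∀ j, μ j ≠ 0)
    (j : Fin m) (y : F) : A (u j) y = ∑ i, C (v i) y * A (u j) (v i) := by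
  have := h.2.apply_eq_sum hC hCpos hv j y
  simp only [_root_.smul_apply, smul_eq_mul] at this
  apply mul_left_cancel₀ (hμ j)
  rw [this, Finset.mul_sum]
  exact Finset.sum_congr rfl fun i _ => by ring

/-- With distinct positive weights, the stationary pairs consist of singular vectors. -/
theorem StationaryPair.singularPairs (hB : ∀ x y, B x y = B y x)
    (hBpos : ∀ x, x ≠ 0 → 0 < B x x) (hC : ∀ x y, C x y = C y x)
    (hCpos : ∀ x, x ≠ 0 → 0 < C x x) (hu : FormOrthonormal B u) (hv : FormOrthonormal C v)
    (h : StationaryPair B C A μ u v) (hμ : ∀ j, 0 < μ j) (hμi : Function.Injective μ) :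
    SingularPairs B C A (fun j => A (u j) (v j)) u v := by
  -- With `a = A (u i) (v j)` and `b = A (u j) (v i)`, the two symmetries read `μ i * b = μ j * a`
  -- and `μ i * a = μ j * b`. Hence `μ j ^ 2 * a = μ i ^ 2 * a`, and positive distinct weights have
  -- distinct squares.
  have hoff : ∀ i j, i ≠ j → A (u i) (v j) = 0 := by
    intro i j hij
    have h1 := h.1.symm hu i j
    have h2 := h.2.symm hv i j
    simp only [_root_.smul_apply, ContinuousLinearMap.flip_apply, smul_eq_mul] at h1 h2
    have h3 : (μ j ^ 2 - μ i ^ 2) * A (u i) (v j) = 0 := by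
      linear_combination μ j * -h1 - μ i * h2
    have h4 : μ j ^ 2 - μ i ^ 2 ≠ 0 := by
      intro h5
      have h6 : (μ j - μ i) * (μ j + μ i) = 0 := by linear_combination h5
      rcases mul_eq_zero.1 h6 with h7 | h7
      · exact hij (hμi (by linarith))
      · linarith [hμ i, hμ j]
    exact (mul_eq_zero.1 h3).resolve_left h4
  refine ⟨fun j x => ?_, fun j y => ?_⟩
  · rw [h.left_eq_sum hB hBpos hu (fun j => (hμ j).ne'), Finset.sum_eq_single j]
    · ring
    · intro i _ hij
      rw [hoff i j hij, mul_zero]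
    · simp
  · rw [h.right_eq_sum hC hCpos hv (fun j => (hμ j).ne'), Finset.sum_eq_single j]
    · ring
    · intro i _ hij
      rw [hoff j i hij.symm, mul_zero]
    · simp

theorem SingularPairs.apply_eq (hu : FormOrthonormal B u) {θ : Fin m → ℝ}
    (h : SingularPairs B C A θ u v) (i j : Fin m) :
    A (u i) (v j) = if i = j then θ j else 0 := by
  rw [h.1, hu j i]
  by_cases hij : i = j
  · simp [hij]
  · simp [hij, Ne.symm hij]

theorem SingularPairs.flip {θ : Fin m → ℝ} (h : SingularPairs B C A θ u v) :
    SingularPairs C B A.flip θ v u :=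
  ⟨fun j y => by simpa using h.2 j y, fun j x => by simpa using h.1 j x⟩

/-- Singular pairs have the first order property of `pairSum` for any weights: all tangent
derivatives vanish. -/
theorem SingularPairs.sum_tangent_eq_zero {θ : Fin m → ℝ} (h : SingularPairs B C A θ u v)
    {ξ : Fin m → E} {η : Fin m → F} (hξ : ∀ j, B (u j) (ξ j) = 0) (hη : ∀ j, C (v j) (η j) = 0) :
    ∑ j, μ j * (A (ξ j) (v j) + A (u j) (η j)) = 0 := by
  refine Finset.sum_eq_zero fun j _ => ?_
  rw [h.1, h.2, hξ, hη]
  ring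

/-- Simultaneous plane rotations do not increase `pairSum` near a local maximizer. -/
theorem eventually_planeRotation_le (hB : ∀ x y, B x y = B y x) (hC : ∀ x y, C x y = C y x)
    (hu : FormOrthonormal B u) (hv : FormOrthonormal C v)
    (h : IsLocalMaxOn (pairSum A μ) (orthonormalPairs B C m) (u, v))
    {e e' : E} (h1 : B e e = 1) (h2 : B e' e' = 1) (h12 : B e e' = 0)
    {d d' : F} (k1 : C d d = 1) (k2 : C d' d' = 1) (k12 : C d d' = 0) :
    ∀ᶠ t in 𝓝 (0 : ℝ), ∑ l, μ l * (A (planeRotation B e e' t (u l))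
      (planeRotation C d d' t (v l)) - A (u l) (v l)) ≤ 0 := by
  have htend : Tendsto (fun t => ((fun j => planeRotation B e e' t (u j),
      fun j => planeRotation C d d' t (v j)) : (Fin m → E) × (Fin m → F))) (𝓝 0)
      (𝓝[orthonormalPairs B C m] (u, v)) := by
    refine tendsto_nhdsWithin_iff.2 ⟨?_, .of_forall fun t =>
      ⟨hu.planeRotation hB h1 h2 h12 t, hv.planeRotation hC k1 k2 k12 t⟩⟩
    have hc : Continuous fun t => ((fun j => planeRotation B e e' t (u j),
        fun j => planeRotation C d d' t (v j)) : (Fin m → E) × (Fin m → F)) :=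
      (continuous_pi fun j => continuous_planeRotation B e e' (u j)).prodMk
        (continuous_pi fun j => continuous_planeRotation C d d' (v j))
    simpa [planeRotation_zero] using hc.tendsto 0
  filter_upwards [htend.eventually h] with t ht
  simp only [mul_sub, Finset.sum_sub_distrib, sub_nonpos]
  exact ht

theorem planeRotation_of_normal {e e' x : E} (h1 : B e x = 0)
    (h2 : B e' x = 0) (t : ℝ) : planeRotation B e e' t x = x := by
  simp [planeRotation, h1, h2]

theorem planeRotation_left {e e' : E} (h1 : B e e = 1) (h12 : B e' e = 0) (t : ℝ) :
    planeRotation B e e' t e = Real.cos t • e + Real.sin t • e' := by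
  simp only [planeRotation, h1, h12]
  module

theorem planeRotation_right {e e' : E} (h2 : B e' e' = 1) (h12 : B e e' = 0) (t : ℝ) :
    planeRotation B e e' t e' = Real.cos t • e' - Real.sin t • e := by
  simp only [planeRotation, h2, h12]
  module

/-- Replacing one pair by an unused one does not increase the singular value. -/
theorem le_of_isLocalMaxOn_of_unused (hB : ∀ x y, B x y = B y x) (hC : ∀ x y, C x y = C y x)
    (hu : FormOrthonormal B u) (hv : FormOrthonormal C v)
    (h : IsLocalMaxOn (pairSum A μ) (orthonormalPairs B C m) (u, v)) {θ : Fin m → ℝ}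
    (hs : SingularPairs B C A θ u v) (hμ : ∀ j, 0 < μ j) {x : E} {y : F} (hx : B x x = 1)
    (hy : C y y = 1) (hxu : ∀ j, B x (u j) = 0) (hyv : ∀ j, C y (v j) = 0) (j : Fin m) :
    A x y ≤ θ j := by
  have key := eventually_planeRotation_le hB hC hu hv h (e := u j) (e' := x) (d := v j) (d' := y)
    (by simp [hu j j]) hx (by rw [hB, hxu]) (by simp [hv j j]) hy (by rw [hC, hyv])
  -- The mixed terms `A (u j) y` and `A x (v j)` vanish, so the joint rotation changes the sum by
  -- exactly `μ j * (A x y - θ j) * sin² t`.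
  have hle : μ j * (A x y - θ j) ≤ 0 := by
    apply sin_sq_coeff_of_eventually_le
    filter_upwards [key] with t ht
    rw [Finset.sum_eq_single j] at ht
    · rw [planeRotation_left (by simp [hu j j]) (hxu j),
        planeRotation_left (by simp [hv j j]) (hyv j)] at ht
      simp only [map_add, map_smul, _root_.add_apply, _root_.smul_apply, smul_eq_mul,
        hs.apply_eq hu, if_true, hs.1 j x, hs.2 j y, hB _ x, hC _ y, hxu, hyv] at ht
      have := Real.sin_sq_add_cos_sq t
      have h2 : Real.cos t ^ 2 = 1 - Real.sin t ^ 2 := by linarith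
      calc μ j * (A x y - θ j) * Real.sin t ^ 2
          = μ j * (Real.cos t ^ 2 * θ j + Real.sin t ^ 2 * A x y - θ j) := by rw [h2]; ring
        _ ≤ 0 := by refine le_trans (le_of_eq ?_) ht; ring
    · intro l _ hl
      rw [planeRotation_of_normal (by simp [hu j l, hl.symm]) (hxu l),
        planeRotation_of_normal (by simp [hv j l, hl.symm]) (hyv l)]
      simp
    · simp
  nlinarith [hμ j]

/-- At a local maximizer the singular values are ordered as the weights. -/
theorem le_of_isLocalMaxOn_of_weight_lt (hB : ∀ x y, B x y = B y x) (hC : ∀ x y, C x y = C y x)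
    (hu : FormOrthonormal B u) (hv : FormOrthonormal C v)
    (h : IsLocalMaxOn (pairSum A μ) (orthonormalPairs B C m) (u, v)) {θ : Fin m → ℝ}
    (hs : SingularPairs B C A θ u v) {i j : Fin m} (hμ : μ j < μ i) : θ j ≤ θ i := by
  have hij : i ≠ j := by rintro rfl; exact lt_irrefl _ hμ
  have hu1 : ∀ i, B (u i) (u i) = 1 := fun i => by simp [hu i i]
  have hv1 : ∀ i, C (v i) (v i) = 1 := fun i => by simp [hv i i]
  have hu0 : ∀ i j, i ≠ j → B (u i) (u j) = 0 := fun i j h => by simp [hu i j, h]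
  have hv0 : ∀ i j, i ≠ j → C (v i) (v j) = 0 := fun i j h => by simp [hv i j, h]
  have key := eventually_planeRotation_le hB hC hu hv h (hu1 i) (hu1 j) (hu0 i j hij)
    (hv1 i) (hv1 j) (hv0 i j hij)
  -- Rotating the pairs `i` and `j` into each other mixes `θ i` and `θ j` with weights `cos² t` and
  -- `sin² t`; the total change is `(μ i - μ j) * (θ j - θ i) * sin² t`.
  have hle : (μ i - μ j) * (θ j - θ i) ≤ 0 := by
    apply sin_sq_coeff_of_eventually_le
    filter_upwards [key] with t ht
    rw [Finset.sum_eq_add i j hij] at ht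
    · rw [planeRotation_left (hu1 i) (hu0 j i hij.symm),
        planeRotation_left (hv1 i) (hv0 j i hij.symm),
        planeRotation_right (hu1 j) (hu0 i j hij),
        planeRotation_right (hv1 j) (hv0 i j hij)] at ht
      simp only [map_add, map_sub, map_smul, _root_.add_apply, _root_.sub_apply,
        _root_.smul_apply, smul_eq_mul, hs.apply_eq hu, if_true, hij, hij.symm, if_false] at ht
      have := Real.sin_sq_add_cos_sq t
      have h2 : Real.cos t ^ 2 = 1 - Real.sin t ^ 2 := by linarith
      refine le_trans (le_of_eq ?_) ht
      linear_combination (-μ i * θ i - μ j * θ j) * h2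
    · intro l _ hl
      rw [planeRotation_of_normal (hu0 i l hl.1.symm) (hu0 j l hl.2.symm),
        planeRotation_of_normal (hv0 i l hl.1.symm) (hv0 j l hl.2.symm)]
      simp
    · simp
    · simp
  nlinarith

/-- A spare direction in one of the two spaces suffices, since only that family is rotated. -/
theorem nonneg_of_isLocalMaxOn [FiniteDimensional ℝ E] [FiniteDimensional ℝ F]
    (hB : ∀ x y, B x y = B y x)
    (hBpos : ∀ x, x ≠ 0 → 0 < B x x) (hC : ∀ x y, C x y = C y x)
    (hCpos : ∀ x, x ≠ 0 → 0 < C x x) (hu : FormOrthonormal B u) (hv : FormOrthonormal C v)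
    (h : IsLocalMaxOn (pairSum A μ) (orthonormalPairs B C m) (u, v)) (hμ : ∀ j, 0 < μ j)
    (hm : m < Module.finrank ℝ E ∨ m < Module.finrank ℝ F) (j : Fin m) :
    0 ≤ A (u j) (v j) := by
  have : 0 ≤ μ j * A (u j) (v j) := by
    rcases hm with hm | hm
    · simpa using apply_nonneg_of_isLocalMaxOn hB hBpos hu (isLocalMaxOn_left_of_pair hv h) hm j
    · simpa using apply_nonneg_of_isLocalMaxOn hC hCpos hv (isLocalMaxOn_right_of_pair hu h) hm j
  exact nonneg_of_mul_nonneg_right this (hμ j)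

end Pairs

/-! ### Classification of the singular pairs and of the local maximizers -/

section Matching

variable {E F : Type*} [NormedAddCommGroup E] [NormedSpace ℝ E]
  [NormedAddCommGroup F] [NormedSpace ℝ F]
  {B : E →L[ℝ] E →L[ℝ] ℝ} {C : F →L[ℝ] F →L[ℝ] ℝ} {A : E →L[ℝ] F →L[ℝ] ℝ}
  {p q : ℕ} {σ : Fin q → ℝ} {u₀ : Fin q → E} {v₀ : Fin q → F}
  {θ : Fin p → ℝ} {u : Fin p → E} {v : Fin p → F}

/-- Singular pairs are orthogonal to the reference pairs for other singular values. -/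
theorem SingularPairs.orthogonal (h₀ : SingularPairs B C A σ u₀ v₀)
    (h : SingularPairs B C A θ u v) (hB : ∀ x y, B x y = B y x)
    (hC : ∀ x y, C x y = C y x) {k : Fin q} {j : Fin p} (hne : θ j ^ 2 ≠ σ k ^ 2) :
    B (u₀ k) (u j) = 0 ∧ C (v₀ k) (v j) = 0 := by
  have h1 : θ j * B (u₀ k) (u j) = σ k * C (v₀ k) (v j) := by
    rw [← h₀.2, h.1, hB]
  have h2 : θ j * C (v₀ k) (v j) = σ k * B (u₀ k) (u j) := by
    rw [← h₀.1, h.2, hC]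
  have h3 : θ j ^ 2 - σ k ^ 2 ≠ 0 := sub_ne_zero.2 hne
  constructor
  · refine (mul_eq_zero.1 (?_ : (θ j ^ 2 - σ k ^ 2) * B (u₀ k) (u j) = 0)).resolve_left h3
    linear_combination θ j * h1 + σ k * h2
  · refine (mul_eq_zero.1 (?_ : (θ j ^ 2 - σ k ^ 2) * C (v₀ k) (v j) = 0)).resolve_left h3
    linear_combination θ j * h2 + σ k * h1

theorem eq_zero_of_form_eq_zero (hpos : ∀ x, x ≠ 0 → 0 < B x x) {x : E}
    (h : ∀ y, B x y = 0) : x = 0 := by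
  by_contra hx
  exact (hpos x hx).ne' (h x)

/-- Here `u₀` is a basis, and `u j` is orthogonal to each `u₀ k` with `σ k ≠ |θ j|`. As `σ` is
injective, one index survives and `u j` is `±u₀ (π j)`. For `θ j > 0` the partner `v j` follows with
the same sign; for `θ j < 0` the sign would be opposite, and for `θ j = 0` the singular equations do
not determine it. -/
theorem exists_matching_left [FiniteDimensional ℝ E] (hB : ∀ x y, B x y = B y x) (hC : ∀ x y, C x y = C y x)
    (hCpos : ∀ x, x ≠ 0 → 0 < C x x) (hu₀ : FormOrthonormal B u₀)
    (h₀ : SingularPairs B C A σ u₀ v₀) (hσi : Function.Injective σ) (hσ : ∀ k, 0 ≤ σ k)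
    (hq : q = Module.finrank ℝ E) (hu : FormOrthonormal B u)
    (h : SingularPairs B C A θ u v) :
    ∃ π : Fin p → Fin q, Function.Injective π ∧ (∀ j, |θ j| = σ (π j)) ∧
      (∀ j, 0 < θ j → ∃ s : ℝ, (s = 1 ∨ s = -1) ∧ u j = s • u₀ (π j) ∧ v j = s • v₀ (π j)) := by
  have hex : ∀ j, ∃ k, |θ j| = σ k := by
    -- Otherwise `u j` would be orthogonal to the whole basis, hence zero.
    intro j
    by_contra! hne
    have h0 : ∀ k, B (u₀ k) (u j) = 0 := fun k => (h₀.orthogonal h hB hC (by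
      rw [← sq_abs (θ j)]
      intro h5
      exact hne k ((sq_eq_sq₀ (abs_nonneg _) (hσ k)).1 h5))).1
    have h1 : u j = 0 := by rw [hu₀.eq_sum hq (u j)]; simp [h0]
    have h2 := hu j j
    simp [h1] at h2
  choose π hπ using hex
  have huπ : ∀ j, u j = B (u₀ (π j)) (u j) • u₀ (π j) := by
    intro j
    conv_lhs => rw [hu₀.eq_sum hq (u j)]
    refine Finset.sum_eq_single (π j) (fun k _ hk => ?_) (by simp)
    rw [(h₀.orthogonal h hB hC (k := k) (j := j) ?_).1, zero_smul]
    rw [← sq_abs (θ j), hπ j]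
    intro h5
    exact hk (hσi ((sq_eq_sq₀ (hσ _) (hσ _)).1 h5)).symm
  have hsq : ∀ j, B (u₀ (π j)) (u j) ^ 2 = 1 := by
    intro j
    have h2 : B (u j) (u j) = 1 := by simp [hu j j]
    nth_rewrite 1 [huπ j] at h2
    simp only [map_smul, _root_.smul_apply, smul_eq_mul] at h2
    rw [sq, h2]
  refine ⟨π, fun i j hij => ?_, hπ, fun j hj => ⟨B (u₀ (π j)) (u j), ?_, huπ j, ?_⟩⟩
  · by_contra hne
    have h2 : B (u i) (u j) = 0 := by simp [hu i j, hne]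
    rw [huπ i] at h2
    simp only [map_smul, _root_.smul_apply, smul_eq_mul] at h2
    rw [hij] at h2
    have h3 := hsq i
    have h4 := hsq j
    rw [hij] at h3
    rcases mul_eq_zero.1 h2 with h5 | h5
    · rw [h5] at h3; norm_num at h3
    · rw [h5] at h4; norm_num at h4
  · exact mul_self_eq_one_iff.1 (by rw [← sq, hsq j])
  -- The functional `A (u j)` equals `θ j` times the form `C (v j)`, so dividing by `θ j` and using
  -- that `C` is definite recovers `v j`.
  · rw [← sub_eq_zero]
    refine eq_zero_of_form_eq_zero hCpos fun y => ?_
    have h5 : σ (π j) = θ j := by rw [← hπ j, abs_of_pos hj]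
    have h6 := h.2 j y
    rw [huπ j] at h6
    simp only [map_smul, _root_.smul_apply, smul_eq_mul, h₀.2, h5] at h6
    apply mul_left_cancel₀ hj.ne'
    simp only [map_sub, map_smul, _root_.sub_apply, _root_.smul_apply, smul_eq_mul]
    linear_combination -h6

/-- If the reference vectors span `F` instead, the two sides exchange roles through `A.flip`. -/
theorem exists_matching [FiniteDimensional ℝ E] [FiniteDimensional ℝ F]
    (hB : ∀ x y, B x y = B y x) (hBpos : ∀ x, x ≠ 0 → 0 < B x x)
    (hC : ∀ x y, C x y = C y x) (hCpos : ∀ x, x ≠ 0 → 0 < C x x)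
    (hu₀ : FormOrthonormal B u₀) (hv₀ : FormOrthonormal C v₀)
    (h₀ : SingularPairs B C A σ u₀ v₀) (hσi : Function.Injective σ) (hσ : ∀ k, 0 ≤ σ k)
    (hq : q = Module.finrank ℝ E ∨ q = Module.finrank ℝ F) (hu : FormOrthonormal B u)
    (hv : FormOrthonormal C v) (h : SingularPairs B C A θ u v) :
    ∃ π : Fin p → Fin q, Function.Injective π ∧ (∀ j, |θ j| = σ (π j)) ∧
      (∀ j, 0 < θ j → ∃ s : ℝ, (s = 1 ∨ s = -1) ∧ u j = s • u₀ (π j) ∧ v j = s • v₀ (π j)) := by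
  rcases hq with hq | hq
  · exact exists_matching_left hB hC hCpos hu₀ h₀ hσi hσ hq hu h
  · obtain ⟨π, h1, h2, h3⟩ :=
      exists_matching_left hC hB hBpos hv₀ h₀.flip hσi hσ hq hv h.flip
    refine ⟨π, h1, h2, fun j hj => ?_⟩
    obtain ⟨s, hs, h4, h5⟩ := h3 j hj
    exact ⟨s, hs, h5, h4⟩

/-- A strictly increasing map whose range is a lower set is the inclusion. -/
theorem eq_castLE_of_strictMono_of_lower {π : Fin p → Fin q} (hpq : p ≤ q) (hπ : StrictMono π)
    (hlow : ∀ j k, k < π j → k ∈ Set.range π) (j : Fin p) : π j = Fin.castLE hpq j := by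
  obtain ⟨n, hn⟩ := j
  induction n using Nat.strong_induction_on with
  | _ n ih =>
    rcases lt_trichotomy (π ⟨n, hn⟩) (Fin.castLE hpq ⟨n, hn⟩) with h | h | h
    · have hlt : (π ⟨n, hn⟩ : ℕ) < n := h
      have h1 := ih _ hlt (hlt.trans hn)
      have h2 : π ⟨π ⟨n, hn⟩, hlt.trans hn⟩ = π ⟨n, hn⟩ := by
        rw [h1]
        ext
        simp
      have h3 := congrArg Fin.val (hπ.injective h2)
      simp only at h3
      omega
    · exact h
    · obtain ⟨⟨i, hi⟩, hik⟩ := hlow _ _ h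
      have h1 : i < n := by
        rw [← hik] at h
        exact hπ.lt_iff_lt.1 h
      have h2 := congrArg Fin.val ((ih i h1 hi).symm.trans hik)
      simp only [Fin.val_castLE] at h2
      omega

/-- The local maximizers of `pairSum` are, up to signs, the leading reference pairs. -/
theorem exists_sign_of_isLocalMaxOn [FiniteDimensional ℝ E] [FiniteDimensional ℝ F]
    (hB : ∀ x y, B x y = B y x) (hBpos : ∀ x, x ≠ 0 → 0 < B x x)
    (hC : ∀ x y, C x y = C y x) (hCpos : ∀ x, x ≠ 0 → 0 < C x x)
    (hu₀ : FormOrthonormal B u₀) (hv₀ : FormOrthonormal C v₀)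
    (h₀ : SingularPairs B C A σ u₀ v₀) (hσa : StrictAnti σ) (hσ : ∀ k, 0 ≤ σ k)
    (hq : q = Module.finrank ℝ E ∨ q = Module.finrank ℝ F) (hpq : p ≤ q)
    (hp : p < Module.finrank ℝ E ∨ p < Module.finrank ℝ F) (hpos : p = q → ∀ k, 0 < σ k)
    {μ : Fin p → ℝ} (hμ : ∀ j, 0 < μ j) (hμa : StrictAnti μ) (hu : FormOrthonormal B u)
    (hv : FormOrthonormal C v)
    (h : IsLocalMaxOn (pairSum A μ) (orthonormalPairs B C p) (u, v)) :
    ∃ s : Fin p → ℝ, (∀ j, s j = 1 ∨ s j = -1) ∧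
      ∀ j, u j = s j • u₀ (Fin.castLE hpq j) ∧ v j = s j • v₀ (Fin.castLE hpq j) := by
  have hs := (StationaryPair.of_isLocalMaxOn hB hC hu hv h).singularPairs hB hBpos hC hCpos hu hv
    hμ hμa.injective
  obtain ⟨π, hπi, hπ, hπs⟩ := exists_matching hB hBpos hC hCpos hu₀ hv₀ h₀ hσa.injective hσ hq hu
    hv hs
  have hθ := nonneg_of_isLocalMaxOn hB hBpos hC hCpos hu hv h hμ hp
  simp only [abs_of_nonneg (hθ _)] at hπ
  -- A reference pair outside the range of `π` is orthogonal to both families, so it can be rotated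
  -- in for any used pair; injectivity of `σ` makes the inequality strict.
  have hunused : ∀ k, k ∉ Set.range π → ∀ j, σ k < σ (π j) := by
    intro k hk j
    have hne : ∀ j, σ k ≠ σ (π j) := fun j h => hk ⟨j, (hσa.injective h).symm⟩
    refine lt_of_le_of_ne ?_ (hne j)
    have horth := fun j => h₀.orthogonal hs hB hC (k := k) (j := j) (by
      rw [hπ j]
      intro h5
      exact hne j ((sq_eq_sq₀ (hσ _) (hσ _)).1 h5).symm)
    have := le_of_isLocalMaxOn_of_unused hB hC hu hv h hs hμ (x := u₀ k) (y := v₀ k)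
      (by simp [hu₀ k k]) (by simp [hv₀ k k]) (fun j => (horth j).1) (fun j => (horth j).2) j
    rw [hπ j, h₀.apply_eq hu₀] at this
    simpa using this
  have hmono : StrictMono π := by
    intro i j hij
    have h1 := le_of_isLocalMaxOn_of_weight_lt hB hC hu hv h hs (hμa hij)
    simp only [hπ] at h1
    exact lt_of_le_of_ne (hσa.le_iff_ge.1 h1) fun h2 => hij.ne (hπi h2)
  -- An index below `π j` carries a larger `σ`, so it cannot be unused.
  have hcast := eq_castLE_of_strictMono_of_lower hpq hmono fun j k hk => by
    by_contra hk'
    exact lt_asymm (hσa hk) (hunused k hk' j)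
  -- Strict positivity is what fixes a common sign for `u j` and `v j`. For `p < q` it comes from an
  -- unused `σ k ≥ 0` lying strictly below; for `p = q` it is assumed.
  have hpos' : ∀ j, 0 < A (u j) (v j) := by
    intro j
    rw [hπ j]
    rcases hpq.eq_or_lt with hpq' | hpq'
    · exact hpos hpq' _
    · obtain ⟨k, hk⟩ : ∃ k, k ∉ Set.range π := by
        by_contra! hall
        have := Fintype.card_le_of_surjective π fun k => hall k
        simp only [Fintype.card_fin] at this
        omega
      exact (hσ k).trans_lt (hunused k hk j)
  choose s hs1 hs2 using fun j => hπs j (hpos' j)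
  refine ⟨s, hs1, fun j => ?_⟩
  rw [← hcast j]
  exact hs2 j

end Matching

/-! ### The canonical weights are singular vectors -/

section Canonical

/-- A real symmetric matrix has an orthogonal diagonalization with decreasing eigenvalues. -/
theorem exists_antitone_diagonalization {q : ℕ} {S : Matrix (Fin q) (Fin q) ℝ}
    (hS : S.transpose = S) :
    ∃ (O : Matrix (Fin q) (Fin q) ℝ) (d : Fin q → ℝ), Antitone d ∧ O.transpose * O = 1 ∧
      O.transpose * S * O = Matrix.diagonal d := by
  have hH : S.IsHermitian := by
    rw [Matrix.IsHermitian, Matrix.conjTranspose_eq_transpose_of_trivial, hS]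
  -- `Tuple.sort` sorts increasingly; negation turns this into decreasing eigenvalues.
  let e := Tuple.sort fun i => -hH.eigenvalues i
  let W : Matrix (Fin q) (Fin q) ℝ := hH.eigenvectorUnitary
  have hW : W.transpose * W = 1 := by
    have := Unitary.coe_star_mul_self hH.eigenvectorUnitary
    rwa [Matrix.star_eq_conjTranspose, Matrix.conjTranspose_eq_transpose_of_trivial] at this
  have hWS : W.transpose * S * W = Matrix.diagonal hH.eigenvalues := by
    have := hH.conjStarAlgAut_star_eigenvectorUnitary
    rw [Unitary.conjStarAlgAut_star_apply, Matrix.star_eq_conjTranspose,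
      Matrix.conjTranspose_eq_transpose_of_trivial] at this
    simpa using this
  refine ⟨W.submatrix id e, hH.eigenvalues ∘ e, ?_, ?_, ?_⟩
  · intro i j hij
    have := Tuple.monotone_sort (fun i => -hH.eigenvalues i) hij
    simpa using this
  · rw [Matrix.transpose_submatrix, ← Matrix.submatrix_mul _ _ _ _ _ Function.bijective_id, hW,
      Matrix.submatrix_one_equiv]
  · rw [← Matrix.submatrix_diagonal_equiv, ← hWS,
      Matrix.submatrix_mul _ _ _ _ _ Function.bijective_id,
      Matrix.submatrix_mul _ _ _ _ _ Function.bijective_id]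
    simp

variable {E F : Type*} [NormedAddCommGroup E] [NormedSpace ℝ E]
  [NormedAddCommGroup F] [NormedSpace ℝ F]
  {B : E →L[ℝ] E →L[ℝ] ℝ} {C : F →L[ℝ] F →L[ℝ] ℝ} {A : E →L[ℝ] F →L[ℝ] ℝ}
  {q : ℕ}

theorem isCompact_orthonormalPairs [FiniteDimensional ℝ E] [FiniteDimensional ℝ F]
    (hBpos : ∀ x, x ≠ 0 → 0 < B x x) (hCpos : ∀ x, x ≠ 0 → 0 < C x x) (m : ℕ) :
    IsCompact (orthonormalPairs B C m) :=
  (isCompact_setOf_formOrthonormal hBpos m).prod (isCompact_setOf_formOrthonormal hCpos m)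

theorem apply_sum_smul_sum_smul (A : E →L[ℝ] F →L[ℝ] ℝ) (u : Fin q → E) (v : Fin q → F)
    (O : Matrix (Fin q) (Fin q) ℝ) (j k : Fin q) :
    A (∑ i, O i j • u i) (∑ i, O i k • v i) =
      (O.transpose * Matrix.of (fun i l => A (u i) (v l)) * O) j k := by
  simp only [map_sum, map_smul, _root_.sum_apply, _root_.smul_apply, smul_eq_mul,
    Matrix.mul_apply, Matrix.transpose_apply, Matrix.of_apply, Finset.mul_sum, Finset.sum_mul]
  exact Finset.sum_congr rfl fun i _ => Finset.sum_congr rfl fun l _ => by ring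

theorem FormOrthonormal.sum_smul {u : Fin q → E} (hu : FormOrthonormal B u)
    {O : Matrix (Fin q) (Fin q) ℝ} (hO : O.transpose * O = 1) :
    FormOrthonormal B fun j => ∑ i, O i j • u i := fun j k => by
  rw [apply_sum_smul_sum_smul]
  have : Matrix.of (fun i l => B (u i) (u l)) = 1 := by
    ext i l
    simp [hu i l, Matrix.one_apply]
  rw [this, mul_one, hO, Matrix.one_apply]

/-- Maximizing the trace under the additional constraint that it is the trace of a sorted
diagonal matrix gives an unconstrained maximizer. -/
theorem isMaxOn_of_diagonal_maximal [FiniteDimensional ℝ E] [FiniteDimensional ℝ F]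
    (hB : ∀ x y, B x y = B y x) (hBpos : ∀ x, x ≠ 0 → 0 < B x x)
    (hC : ∀ x y, C x y = C y x) (hCpos : ∀ x, x ≠ 0 → 0 < C x x)
    {u₀ : Fin q → E} {v₀ : Fin q → F} (hu₀ : FormOrthonormal B u₀) (hv₀ : FormOrthonormal C v₀)
    (hmax : ∀ (d : Fin q → ℝ) (u : Fin q → E) (v : Fin q → F), Antitone d →
      FormOrthonormal B u → FormOrthonormal C v →
      (∀ i j, A (u i) (v j) = if i = j then d i else 0) →
      ∑ j, A (u j) (v j) ≤ ∑ j, A (u₀ j) (v₀ j)) :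
    IsMaxOn (pairSum A fun _ => 1) (orthonormalPairs B C q) (u₀, v₀) := by
  obtain ⟨⟨u₁, v₁⟩, ⟨hu₁, hv₁⟩, h₁⟩ := (isCompact_orthonormalPairs hBpos hCpos q).exists_isMaxOn
    ⟨(u₀, v₀), hu₀, hv₀⟩ (continuous_pairSum A (m := q) fun _ => 1).continuousOn
  simp only at hu₁ hv₁
  have hst := StationaryPair.of_isLocalMaxOn hB hC hu₁ hv₁ h₁.localize
  -- At an unconstrained maximizer with unit weights, `S` is symmetric by stationarity. Mixing both
  -- families with the same orthogonal `O` diagonalizes it and keeps the trace, which yields a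
  -- competitor admissible in `hmax`.
  let S : Matrix (Fin q) (Fin q) ℝ := Matrix.of fun i l => A (u₁ i) (v₁ l)
  have hS : S.transpose = S := by
    ext i j
    have := hst.1.symm hu₁ i j
    simpa [S] using this
  obtain ⟨O, d, hd, hO, hOS⟩ := exists_antitone_diagonalization hS
  have h2 := hmax d _ _ hd (hu₁.sum_smul hO) (hv₁.sum_smul hO) fun i j => by
    rw [apply_sum_smul_sum_smul, hOS, Matrix.diagonal_apply]
  have h3 : ∑ j, A (∑ i, O i j • u₁ i) (∑ i, O i j • v₁ i) = ∑ j, A (u₁ j) (v₁ j) := by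
    simp only [apply_sum_smul_sum_smul]
    change (O.transpose * S * O).trace = S.trace
    rw [Matrix.trace_mul_comm, ← mul_assoc, mul_eq_one_comm.1 hO, one_mul]
  rw [h3] at h2
  intro w hw
  refine le_trans (h₁ hw) (?_ : pairSum A (fun _ => 1) (u₁, v₁) ≤ _)
  simpa [pairSum] using h2

/-- The weights are all one, so `StationaryPair.singularPairs` does not apply; the off-diagonal
terms vanish here by the diagonal constraint `hσ`, and the stationary expansions collapse. -/
theorem singularPairs_of_diagonal_maximal [FiniteDimensional ℝ E] [FiniteDimensional ℝ F]
    (hB : ∀ x y, B x y = B y x) (hBpos : ∀ x, x ≠ 0 → 0 < B x x)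
    (hC : ∀ x y, C x y = C y x) (hCpos : ∀ x, x ≠ 0 → 0 < C x x)
    {u₀ : Fin q → E} {v₀ : Fin q → F} (hu₀ : FormOrthonormal B u₀) (hv₀ : FormOrthonormal C v₀)
    {σ : Fin q → ℝ} (hσ : ∀ i j, A (u₀ i) (v₀ j) = if i = j then σ i else 0)
    (hmax : ∀ (d : Fin q → ℝ) (u : Fin q → E) (v : Fin q → F), Antitone d →
      FormOrthonormal B u → FormOrthonormal C v →
      (∀ i j, A (u i) (v j) = if i = j then d i else 0) →
      ∑ j, A (u j) (v j) ≤ ∑ j, A (u₀ j) (v₀ j)) :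
    SingularPairs B C A σ u₀ v₀ ∧ ∀ k, 0 ≤ σ k := by
  have h := isMaxOn_of_diagonal_maximal hB hBpos hC hCpos hu₀ hv₀ hmax
  have hst := StationaryPair.of_isLocalMaxOn hB hC hu₀ hv₀ h.localize
  refine ⟨⟨fun j x => ?_, fun j y => ?_⟩, fun k => ?_⟩
  · rw [hst.left_eq_sum hB hBpos hu₀ (fun _ => one_ne_zero)]
    simp [hσ, mul_comm]
  · rw [hst.right_eq_sum hC hCpos hv₀ (fun _ => one_ne_zero)]
    simp [hσ, mul_comm]
  -- Negating the single vector `u₀ k` changes the sum by `-2 * σ k`, which maximality forbids from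
  -- being positive.
  · let s : Fin q → ℝ := fun j => if j = k then -1 else 1
    have hs : ∀ j, s j = 1 ∨ s j = -1 := fun j => by
      by_cases hj : j = k <;> simp [s, hj]
    have h1 := h (a := ((fun j => s j • u₀ j), v₀)) ⟨hu₀.smul_sign hs, hv₀⟩
    simp only [pairSum, map_smul, _root_.smul_apply, smul_eq_mul, one_mul, hσ, if_true,
      Set.mem_ofPred_eq] at h1
    rw [← sub_nonneg, ← Finset.sum_sub_distrib, Finset.sum_eq_single k] at h1
    · simp only [s, if_true] at h1
      linarith
    · intro j _ hj
      simp [s, hj]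
    · simp

/-- At singular pairs `pairSum` takes only finitely many values. -/
theorem finite_pairSum_singularPairs [FiniteDimensional ℝ E] [FiniteDimensional ℝ F]
    (hB : ∀ x y, B x y = B y x) (hBpos : ∀ x, x ≠ 0 → 0 < B x x)
    (hC : ∀ x y, C x y = C y x) (hCpos : ∀ x, x ≠ 0 → 0 < C x x)
    {u₀ : Fin q → E} {v₀ : Fin q → F} {σ : Fin q → ℝ} (hu₀ : FormOrthonormal B u₀)
    (hv₀ : FormOrthonormal C v₀) (h₀ : SingularPairs B C A σ u₀ v₀)
    (hσi : Function.Injective σ) (hσ : ∀ k, 0 ≤ σ k)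
    (hq : q = Module.finrank ℝ E ∨ q = Module.finrank ℝ F) {p : ℕ} (μ : Fin p → ℝ) :
    {c | ∃ u v θ, FormOrthonormal B u ∧ FormOrthonormal C v ∧ SingularPairs B C A θ u v ∧
      c = pairSum A μ (u, v)}.Finite := by
  -- Each `θ j` is some `±σ k`, and `θ` determines the value of `pairSum`.
  have hfin : (Set.univ.pi fun _ : Fin p => Set.range σ ∪ Set.range fun k => -σ k).Finite :=
    Set.Finite.pi fun _ => (Set.finite_range _).union (Set.finite_range _)
  refine (hfin.image fun θ => ∑ j, μ j * θ j).subset ?_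
  rintro c ⟨u, v, θ, hu, hv, h, rfl⟩
  refine ⟨θ, fun j _ => ?_, ?_⟩
  · obtain ⟨π, -, hπ, -⟩ := exists_matching hB hBpos hC hCpos hu₀ hv₀ h₀ hσi hσ hq hu hv h
    rcases abs_choice (θ j) with h1 | h1
    · exact .inl ⟨π j, by rw [← hπ j, h1]⟩
    · exact .inr ⟨π j, by simp only [← hπ j, h1, neg_neg]⟩
  · simp [pairSum, h.apply_eq hu]

end Canonical

/-! ### Minimizers and stability of descent mappings on compact spaces -/

section Stability

variable {α : Type*} [TopologicalSpace α] {f : α → ℝ} {F : α → α} {x : α}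

theorem MapClusterPt.mem_of_isClosed {β : Type*} {l : Filter β} {g : β → α} {S : Set α}
    (hx : MapClusterPt x l g) (hS : IsClosed S) (h : ∀ b, g b ∈ S) : x ∈ S := by
  by_contra hxS
  obtain ⟨b, hb⟩ := (hx.frequently (hS.isOpen_compl.mem_nhds hxS)).exists
  exact hb (h b)

theorem IsStrictLocalMinimizer.isLocalMin (h : IsStrictLocalMinimizer f x) : IsLocalMin f x := by
  filter_upwards [eventually_nhdsWithin_iff.1 h] with y hy
  rcases eq_or_ne y x with rfl | hne
  · exact le_rfl
  · exact (hy hne).le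

theorem IsDescentMapping.iterate_le {α : Type*} {f : α → ℝ} {F : α → α}
    (hF : IsDescentMapping f F) (x : α) (k : ℕ) :
    f (F^[k] x) ≤ f x := by
  induction k with
  | zero => exact le_rfl
  | succ k ih =>
    rw [Function.iterate_succ_apply']
    exact (hF _).trans ih

/-- If there are finitely many global minimizers, each of them is a strict local minimizer. -/
theorem isStrictLocalMinimizer_of_finite [T1Space α] (hmin : ∀ y, f x ≤ f y)
    (hfin : {y | f y = f x}.Finite) : IsStrictLocalMinimizer f x := by
  have h1 : ({y | f y = f x} \ {x})ᶜ ∈ 𝓝 x :=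
    hfin.sdiff.isClosed.isOpen_compl.mem_nhds (by simp)
  filter_upwards [mem_nhdsWithin_of_mem_nhds h1, self_mem_nhdsWithin] with y hy hyx
  refine lt_of_le_of_ne (hmin y) fun h => hy ⟨h.symm, hyx⟩

/-- A strict local minimizer is stable under a descent mapping that is continuous there. -/
theorem IsStrictLocalMinimizer.isStablePoint [CompactSpace α] [T2Space α] (hf : Continuous f)
    (hx : IsStrictLocalMinimizer f x) (hF : IsDescentMapping f F) (hFx : Tendsto F (𝓝 x) (𝓝 x)) :
    IsStablePoint F x := by
  intro O hO
  obtain ⟨N, hN, hNsub, hNcl⟩ : ∃ N ∈ 𝓝 x, N ⊆ O ∩ {y | y ≠ x → f x < f y} ∧ IsClosed N := by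
    obtain ⟨N, hN, hcl, hsub⟩ := exists_mem_nhds_isClosed_subset
      (inter_mem hO (eventually_nhdsWithin_iff.1 hx))
    exact ⟨N, hN, hsub, hcl⟩
  -- `F` maps `V` into `N`, so one step from `V` cannot jump over the shell `N \ V`.
  obtain ⟨V, hVsub, hVo, hxV⟩ := mem_nhds_iff.1 (inter_mem hN (hFx hN))
  -- The barrier `c` is the minimum of `f` on the compact shell, or any number above `f x` if the
  -- shell is empty. Below this level an orbit cannot enter the shell.
  obtain ⟨c, hc, hcK⟩ : ∃ c, f x < c ∧ ∀ y ∈ N \ V, c ≤ f y := by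
    rcases (N \ V).eq_empty_or_nonempty with h | h
    · exact ⟨f x + 1, by linarith, by simp [h]⟩
    · obtain ⟨z, hz, hzmin⟩ := (hNcl.sdiff hVo).isCompact.exists_isMinOn h hf.continuousOn
      refine ⟨f z, (hNsub hz.1).2 ?_, fun y hy => hzmin hy⟩
      rintro rfl
      exact hz.2 hxV
  refine ⟨V ∩ {y | f y < c}, inter_mem (hVo.mem_nhds hxV)
    ((isOpen_lt hf continuous_const).mem_nhds hc), fun y hy k => ?_⟩
  suffices F^[k] y ∈ V ∩ {y | f y < c} from (hNsub (hVsub this.1).1).1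
  induction k with
  | zero => exact hy
  | succ k ih =>
    rw [Function.iterate_succ_apply']
    have hlt : f (F (F^[k] y)) < c := (hF _).trans_lt ih.2
    refine ⟨?_, hlt⟩
    by_contra hV
    exact (hcK _ ⟨(hVsub ih.1).2, hV⟩).not_gt hlt

/-- A strict local minimizer is asymptotically stable under a descent mapping that is continuous
there, if the accumulation points of the iterates have only finitely many values. -/
theorem IsStrictLocalMinimizer.isAsymptoticallyStablePoint [CompactSpace α] [T2Space α]
    (hf : Continuous f) (hx : IsStrictLocalMinimizer f x)
    (hF : IsDescentMapping f F) (hFx : Tendsto F (𝓝 x) (𝓝 x)) {T : Set ℝ} (hT : T.Finite)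
    (hcl : ∀ z w, MapClusterPt w atTop (fun k : ℕ => F^[k] z) → f w ∈ T) :
    IsAsymptoticallyStablePoint F x := by
  have hst := hx.isStablePoint hf hF hFx
  refine ⟨hst, ?_⟩
  obtain ⟨N, hN, hNcl, hNsub⟩ := exists_mem_nhds_isClosed_subset (eventually_nhdsWithin_iff.1 hx)
  obtain ⟨O, hO, hON⟩ := hst N hN
  -- Starting values close to `f x` lie below every element of `T` above `f x`. A cluster point in
  -- `N` other than `x` would have its value in `T`, above `f x` and at most `f y`.
  have hT' : ∀ᶠ y in 𝓝 x, ∀ t ∈ T, f x < t → f y < t := by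
    rw [hT.eventually_all]
    intro t _
    by_cases ht : f x < t
    · filter_upwards [(isOpen_lt hf continuous_const).mem_nhds ht] with y hy _ using hy
    · exact .of_forall fun y h => absurd h ht
  filter_upwards [hO, hT'] with y hy hyT
  refine tendsto_nhds_of_unique_mapClusterPt fun w hw => ?_
  have hwN : w ∈ N := hw.mem_of_isClosed hNcl fun k => hON y hy k
  have hwy : f w ≤ f y :=
    MapClusterPt.mem_of_isClosed (S := {z | f z ≤ f y}) hw (isClosed_le hf continuous_const)
      fun k => hF.iterate_le y k
  by_contra hne
  exact (hyT _ (hcl y w hw) (hNsub hwN hne)).not_ge hwy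

/-- A point that is not a local minimizer is not stable under a descent mapping, if the
accumulation points of the iterates have only finitely many values. -/
theorem not_isStablePoint_of_not_isLocalMin [CompactSpace α]
    (hf : Continuous f) (hx : ¬ IsLocalMin f x)
    (hF : IsDescentMapping f F) {T : Set ℝ} (hT : T.Finite)
    (hcl : ∀ z w, MapClusterPt w atTop (fun k : ℕ => F^[k] z) → f w ∈ T) :
    ¬ IsStablePoint F x := by
  intro hst
  -- The level `c` separates `f x` from the finitely many elements of `T` below it. Stability would
  -- keep nearby orbits above `c`, yet an orbit starting below `f x` has a cluster value in `T`
  -- below `f x`, hence below `c`.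
  obtain ⟨c, hc, hcT⟩ : ∃ c < f x, ∀ t ∈ T, t < f x → t < c := by
    have h1 : ∀ᶠ c in 𝓝[<] (f x), ∀ t ∈ T, t < f x → t < c := by
      rw [hT.eventually_all]
      intro t _
      by_cases ht : t < f x
      · filter_upwards [mem_nhdsWithin_of_mem_nhds (Ioi_mem_nhds ht)] with c hc _ using hc
      · exact .of_forall fun _ h => absurd h ht
    obtain ⟨c, h2, h3⟩ := (h1.and self_mem_nhdsWithin).exists
    exact ⟨c, h3, h2⟩
  obtain ⟨O, hO, hOc⟩ := hst {y | c ≤ f y}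
    (mem_of_superset ((isOpen_lt continuous_const hf).mem_nhds hc) fun y (hy : c < f y) => hy.le)
  obtain ⟨y, hyx, hyO⟩ : ∃ y, f y < f x ∧ y ∈ O := by
    have h1 : ∃ᶠ y in 𝓝 x, f y < f x := by
      simpa [IsLocalMin, IsMinFilter, Filter.not_eventually] using hx
    exact (h1.and_eventually hO).exists
  obtain ⟨w, hw⟩ := exists_clusterPt_of_compactSpace (map (fun k : ℕ => F^[k] y) atTop)
  have h1 : c ≤ f w :=
    MapClusterPt.mem_of_isClosed (S := {z | c ≤ f z}) hw (isClosed_le continuous_const hf)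
      fun k => hOc y hyO k
  have h2 : f w ≤ f y :=
    MapClusterPt.mem_of_isClosed (S := {z | f z ≤ f y}) hw (isClosed_le hf continuous_const)
      fun k => hF.iterate_le y k
  exact (hcT _ (hcl y w hw) (h2.trans_lt hyx)).not_ge h1

end Stability

/-! ### Matrices and families of columns -/

section Columns

/-- The continuous bilinear form `x ⬝ᵥ S *ᵥ y` of a matrix `S`. -/
noncomputable def matrixForm {a b : ℕ} (S : Matrix (Fin a) (Fin b) ℝ) :
    (Fin a → ℝ) →L[ℝ] (Fin b → ℝ) →L[ℝ] ℝ :=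
  (Matrix.toLinearMap₂' ℝ S).toContinuousBilinearMap

theorem matrixForm_apply {a b : ℕ} (S : Matrix (Fin a) (Fin b) ℝ) (x : Fin a → ℝ)
    (y : Fin b → ℝ) : matrixForm S x y = x ⬝ᵥ S.mulVec y := by
  rw [matrixForm, LinearMap.toContinuousBilinearMap_apply, Matrix.toLinearMap₂'_apply']

/-- A transposed matrix, read as a function, is the family of its columns; this passes from matrix
identities to identities of forms. -/
theorem matrixForm_columns {a b k l : ℕ} (S : Matrix (Fin a) (Fin b) ℝ)
    (U : Matrix (Fin a) (Fin k) ℝ) (V : Matrix (Fin b) (Fin l) ℝ) (i : Fin k) (j : Fin l) :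
    matrixForm S (U.transpose i) (V.transpose j) = (U.transpose * S * V) i j := by
  rw [matrixForm_apply, Matrix.mul_assoc]
  rfl

theorem matrixForm_comm {a : ℕ} {S : Matrix (Fin a) (Fin a) ℝ} (hS : S.PosDef)
    (x y : Fin a → ℝ) : matrixForm S x y = matrixForm S y x := by
  have h : S.transpose = S := by
    rw [← Matrix.conjTranspose_eq_transpose_of_trivial, hS.isHermitian]
  rw [matrixForm_apply, matrixForm_apply, Matrix.dotProduct_mulVec, ← Matrix.mulVec_transpose, h,
    dotProduct_comm]

theorem matrixForm_self_pos {a : ℕ} {S : Matrix (Fin a) (Fin a) ℝ} (hS : S.PosDef)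
    (x : Fin a → ℝ) (hx : x ≠ 0) : 0 < matrixForm S x x := by
  rw [matrixForm_apply]
  simpa using hS.dotProduct_mulVec_pos hx

theorem mem_genStiefel_iff {a m : ℕ} {S : Matrix (Fin a) (Fin a) ℝ}
    {W : Matrix (Fin a) (Fin m) ℝ} :
    W ∈ genStiefel S m ↔ FormOrthonormal (matrixForm S) W.transpose := by
  simp only [FormOrthonormal, matrixForm_columns]
  rw [genStiefel, Set.mem_ofPred_eq, ← Matrix.ext_iff]
  simp only [Matrix.one_apply]

theorem mem_stiefelTangent_iff {a m : ℕ} {S : Matrix (Fin a) (Fin a) ℝ}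
    {W ξ : Matrix (Fin a) (Fin m) ℝ} :
    ξ ∈ stiefelTangent S W ↔ ∀ i j, matrixForm S (ξ.transpose i) (W.transpose j) +
      matrixForm S (W.transpose i) (ξ.transpose j) = 0 := by
  simp only [matrixForm_columns]
  rw [stiefelTangent, Set.mem_ofPred_eq, ← Matrix.ext_iff]
  simp only [Matrix.add_apply, Matrix.zero_apply]

variable {dx dy p : ℕ}

/-- The columns of the two blocks of a stacked matrix. -/
def columnPair (Z : Matrix (Fin dx ⊕ Fin dy) (Fin p) ℝ) :
    (Fin p → Fin dx → ℝ) × (Fin p → Fin dy → ℝ) :=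
  (Z.toRows₁.transpose, Z.toRows₂.transpose)

/-- The stacked matrix with given columns of the two blocks. -/
def ofColumnPair (w : (Fin p → Fin dx → ℝ) × (Fin p → Fin dy → ℝ)) :
    Matrix (Fin dx ⊕ Fin dy) (Fin p) ℝ :=
  Matrix.of fun i j => Sum.elim (w.1 j) (w.2 j) i

theorem columnPair_ofColumnPair (w : (Fin p → Fin dx → ℝ) × (Fin p → Fin dy → ℝ)) :
    columnPair (ofColumnPair w) = w := rfl

theorem ofColumnPair_columnPair (Z : Matrix (Fin dx ⊕ Fin dy) (Fin p) ℝ) :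
    ofColumnPair (columnPair Z) = Z := by
  ext i j
  rcases i with i | i <;> rfl

theorem continuous_columnPair :
    Continuous (columnPair : Matrix (Fin dx ⊕ Fin dy) (Fin p) ℝ → _) := by
  refine Continuous.prodMk ?_ ?_ <;>
  exact continuous_pi fun j => continuous_pi fun i => continuous_id.matrix_elem _ _

theorem continuous_ofColumnPair :
    Continuous (ofColumnPair : (Fin p → Fin dx → ℝ) × (Fin p → Fin dy → ℝ) → _) := by
  refine continuous_matrix fun i j => ?_
  rcases i with i | i <;> simp only [ofColumnPair, Matrix.of_apply, Sum.elim_inl, Sum.elim_inr] <;>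
  fun_prop

theorem mem_prodStiefel_iff {Sxx : Matrix (Fin dx) (Fin dx) ℝ} {Syy : Matrix (Fin dy) (Fin dy) ℝ}
    {Z : Matrix (Fin dx ⊕ Fin dy) (Fin p) ℝ} :
    Z ∈ prodStiefel Sxx Syy p ↔
      columnPair Z ∈ orthonormalPairs (matrixForm Sxx) (matrixForm Syy) p :=
  and_congr mem_genStiefel_iff mem_genStiefel_iff

theorem isCompact_prodStiefel {Sxx : Matrix (Fin dx) (Fin dx) ℝ}
    {Syy : Matrix (Fin dy) (Fin dy) ℝ} (hx : Sxx.PosDef) (hy : Syy.PosDef) (p : ℕ) :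
    IsCompact (prodStiefel Sxx Syy p) := by
  have h := (isCompact_orthonormalPairs (matrixForm_self_pos hx) (matrixForm_self_pos hy) p).image
    continuous_ofColumnPair
  convert h using 1
  ext Z
  rw [mem_prodStiefel_iff]
  refine ⟨fun hZ => ⟨_, hZ, ofColumnPair_columnPair Z⟩, ?_⟩
  rintro ⟨w, hw, rfl⟩
  exact hw

/-- The block matrix contributes `Uᵀ Sxy V` and its transpose, whose diagonals agree; this absorbs
the factor `1 / 2`. -/
theorem ccaCost_eq (Sxy : Matrix (Fin dx) (Fin dy) ℝ) (μ : Fin p → ℝ)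
    (Z : Matrix (Fin dx ⊕ Fin dy) (Fin p) ℝ) :
    ccaCost Sxy μ Z = -pairSum (matrixForm Sxy) μ (columnPair Z) := by
  have h : Z.transpose * Matrix.fromBlocks 0 Sxy Sxy.transpose 0 * Z =
      (Z.toRows₁.transpose * Sxy * Z.toRows₂).transpose +
        Z.toRows₁.transpose * Sxy * Z.toRows₂ := by
    conv_lhs => rw [← Matrix.fromRows_toRows Z]
    rw [Matrix.transpose_fromRows, Matrix.fromCols_mul_fromBlocks, Matrix.fromCols_mul_fromRows]
    simp [Matrix.mul_assoc]
  simp only [ccaCost, h, Matrix.trace, Matrix.diag_apply, Matrix.mul_diagonal, Matrix.add_apply,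
    Matrix.transpose_apply, pairSum, columnPair, matrixForm_columns, Finset.mul_sum]
  rw [← Finset.sum_neg_distrib]
  exact Finset.sum_congr rfl fun j _ => by ring

theorem isLocalMaxOn_pairSum_of_isLocalMin {Sxx : Matrix (Fin dx) (Fin dx) ℝ}
    {Syy : Matrix (Fin dy) (Fin dy) ℝ} {Sxy : Matrix (Fin dx) (Fin dy) ℝ} {μ : Fin p → ℝ}
    {Z : prodStiefel Sxx Syy p}
    (h : IsLocalMin (fun Z : prodStiefel Sxx Syy p => ccaCost Sxy μ Z.1) Z) :
    IsLocalMaxOn (pairSum (matrixForm Sxy) μ)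
      (orthonormalPairs (matrixForm Sxx) (matrixForm Syy) p) (columnPair Z.1) := by
  have h1 : ∀ᶠ W in 𝓝[prodStiefel Sxx Syy p] Z.1, ccaCost Sxy μ Z.1 ≤ ccaCost Sxy μ W := by
    rw [nhdsWithin_eq_map_subtype_coe Z.2]
    exact h
  have h2 : Tendsto ofColumnPair
      (𝓝[orthonormalPairs (matrixForm Sxx) (matrixForm Syy) p] (columnPair Z.1))
      (𝓝[prodStiefel Sxx Syy p] Z.1) := by
    refine tendsto_nhdsWithin_iff.2 ⟨?_, eventually_nhdsWithin_of_forall fun w hw =>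
      mem_prodStiefel_iff.2 hw⟩
    have := (continuous_ofColumnPair (p := p)).tendsto (columnPair Z.1)
    rw [ofColumnPair_columnPair] at this
    exact this.mono_left nhdsWithin_le_nhds
  filter_upwards [h2.eventually h1] with w hw
  simp only [ccaCost_eq, columnPair_ofColumnPair] at hw
  linarith

/-! ### Critical points -/

/-- The cost is a quadratic form, so on a line it is a polynomial of degree at most two in `t`, and
the derivative is its linear coefficient. -/
theorem lineDeriv_ccaCost (Sxy : Matrix (Fin dx) (Fin dy) ℝ) (μ : Fin p → ℝ)
    (Z ξ : Matrix (Fin dx ⊕ Fin dy) (Fin p) ℝ) :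
    lineDeriv ℝ (ccaCost Sxy μ) Z ξ =
      -∑ j, μ j * (matrixForm Sxy ((columnPair ξ).1 j) ((columnPair Z).2 j) +
        matrixForm Sxy ((columnPair Z).1 j) ((columnPair ξ).2 j)) := by
  have h : (fun t : ℝ => ccaCost Sxy μ (Z + t • ξ)) = fun t : ℝ => ccaCost Sxy μ Z +
      t * (-∑ j, μ j * (matrixForm Sxy ((columnPair ξ).1 j) ((columnPair Z).2 j) +
        matrixForm Sxy ((columnPair Z).1 j) ((columnPair ξ).2 j))) +
      t ^ 2 * ccaCost Sxy μ ξ := by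
    funext t
    have h1 : ∀ j, (columnPair (Z + t • ξ)).1 j = (columnPair Z).1 j + t • (columnPair ξ).1 j :=
      fun j => rfl
    have h2 : ∀ j, (columnPair (Z + t • ξ)).2 j = (columnPair Z).2 j + t • (columnPair ξ).2 j :=
      fun j => rfl
    simp only [ccaCost_eq, pairSum, h1, h2, map_add, map_smul, _root_.add_apply,
      _root_.smul_apply, smul_eq_mul, mul_neg, Finset.mul_sum, ← Finset.sum_neg_distrib,
      ← Finset.sum_add_distrib]
    exact Finset.sum_congr rfl fun j _ => by ring
  rw [lineDeriv, h]
  generalize (-∑ j, μ j * (matrixForm Sxy ((columnPair ξ).1 j) ((columnPair Z).2 j) +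
        matrixForm Sxy ((columnPair Z).1 j) ((columnPair ξ).2 j))) = c
  have hd := (((hasDerivAt_id (0 : ℝ)).mul_const c).const_add (ccaCost Sxy μ Z)).add
    (((hasDerivAt_id (0 : ℝ)).pow 2).mul_const (ccaCost Sxy μ ξ))
  refine hd.deriv.trans ?_
  simp

/-- The critical points are the points whose columns are pairs of singular vectors. -/
theorem isRiemannianCritical_iff {Sxx Mx : Matrix (Fin dx) (Fin dx) ℝ}
    {Syy My : Matrix (Fin dy) (Fin dy) ℝ} {Sxy : Matrix (Fin dx) (Fin dy) ℝ} {μ : Fin p → ℝ}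
    (hx : Sxx.PosDef) (hy : Syy.PosDef) (hμ : ∀ j, 0 < μ j) (hμi : Function.Injective μ)
    (Z : prodStiefel Sxx Syy p) :
    IsRiemannianCritical Sxx Syy Mx My (ccaCost Sxy μ) Z ↔
      ∃ θ, SingularPairs (matrixForm Sxx) (matrixForm Syy) (matrixForm Sxy) θ
        (columnPair Z.1).1 (columnPair Z.1).2 := by
  have hZ := mem_prodStiefel_iff.1 Z.2
  constructor
  · intro h
    -- The metric drops out because the gradient is zero, so criticality does not depend on `Mx` and
    -- `My`.
    have hcrit : ∀ ξ ∈ prodTangent Sxx Syy Z.1,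
        ∑ j, μ j * (matrixForm Sxy ((columnPair ξ).1 j) ((columnPair Z.1).2 j) +
        matrixForm Sxy ((columnPair Z.1).1 j) ((columnPair ξ).2 j)) = 0 := by
      intro ξ hξ
      have h1 := h.2 ξ hξ
      rw [lineDeriv_ccaCost] at h1
      simpa [precondMetric] using h1.symm
    refine ⟨_, StationaryPair.singularPairs (matrixForm_comm hx) (matrixForm_self_pos hx)
      (matrixForm_comm hy) (matrixForm_self_pos hy) hZ.1 hZ.2 (μ := μ) ⟨?_, ?_⟩ hμ hμi⟩
    · intro e e' _ _ _
      -- The test vector is the velocity at `t = 0` of the plane rotation of the first block.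
      have h2 := hcrit (ofColumnPair (fun j =>
        matrixForm Sxx e ((columnPair Z.1).1 j) • e' -
          matrixForm Sxx e' ((columnPair Z.1).1 j) • e, 0)) ⟨?_, ?_⟩
      · rw [columnPair_ofColumnPair] at h2
        rw [← h2]
        refine Finset.sum_congr rfl fun j _ => ?_
        simp
        ring
      · refine mem_stiefelTangent_iff.2 fun i j => ?_
        change matrixForm Sxx (matrixForm Sxx e ((columnPair Z.1).1 i) • e' -
          matrixForm Sxx e' ((columnPair Z.1).1 i) • e) ((columnPair Z.1).1 j) +
          matrixForm Sxx ((columnPair Z.1).1 i) (matrixForm Sxx e ((columnPair Z.1).1 j) • e' -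
          matrixForm Sxx e' ((columnPair Z.1).1 j) • e) = 0
        simp only [map_sub, map_smul, _root_.sub_apply, _root_.smul_apply, smul_eq_mul,
          matrixForm_comm hx ((columnPair Z.1).1 i) _]
        ring
      · refine mem_stiefelTangent_iff.2 fun i j => ?_
        change matrixForm Syy 0 _ + matrixForm Syy _ 0 = 0
        simp
    · intro e e' _ _ _
      have h2 := hcrit (ofColumnPair (0, fun j =>
        matrixForm Syy e ((columnPair Z.1).2 j) • e' -
          matrixForm Syy e' ((columnPair Z.1).2 j) • e)) ⟨?_, ?_⟩
      · rw [columnPair_ofColumnPair] at h2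
        rw [← h2]
        refine Finset.sum_congr rfl fun j _ => ?_
        simp
        ring
      · refine mem_stiefelTangent_iff.2 fun i j => ?_
        change matrixForm Sxx 0 _ + matrixForm Sxx _ 0 = 0
        simp
      · refine mem_stiefelTangent_iff.2 fun i j => ?_
        change matrixForm Syy (matrixForm Syy e ((columnPair Z.1).2 i) • e' -
          matrixForm Syy e' ((columnPair Z.1).2 i) • e) ((columnPair Z.1).2 j) +
          matrixForm Syy ((columnPair Z.1).2 i) (matrixForm Syy e ((columnPair Z.1).2 j) • e' -
          matrixForm Syy e' ((columnPair Z.1).2 j) • e) = 0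
        simp only [map_sub, map_smul, _root_.sub_apply, _root_.smul_apply, smul_eq_mul,
          matrixForm_comm hy ((columnPair Z.1).2 i) _]
        ring
  · rintro ⟨θ, h⟩
    refine ⟨⟨?_, ?_⟩, fun ξ hξ => ?_⟩
    · refine mem_stiefelTangent_iff.2 fun i j => ?_
      change matrixForm Sxx 0 _ + matrixForm Sxx _ 0 = 0
      simp
    · refine mem_stiefelTangent_iff.2 fun i j => ?_
      change matrixForm Syy 0 _ + matrixForm Syy _ 0 = 0
      simp
    · rw [lineDeriv_ccaCost, h.sum_tangent_eq_zero]
      · simp [precondMetric]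
      · intro j
        -- By symmetry of the form, the diagonal tangency equation says that `ξ j` is orthogonal to
        -- the `j`-th column.
        have := mem_stiefelTangent_iff.1 hξ.1 j j
        rw [matrixForm_comm hx] at this
        exact self_eq_neg.1 (eq_neg_of_add_eq_zero_left this)
      · intro j
        have := mem_stiefelTangent_iff.1 hξ.2 j j
        rw [matrixForm_comm hy] at this
        exact self_eq_neg.1 (eq_neg_of_add_eq_zero_left this)

/-! ### Sign changes of columns -/

theorem ColumnSignEquiv.symm {m : Type*} {W Z : Matrix m (Fin p) ℝ} (h : ColumnSignEquiv W Z) :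
    ColumnSignEquiv Z W := by
  obtain ⟨s, hs, rfl⟩ := h
  refine ⟨s, hs, ?_⟩
  ext i j
  rcases hs j with h | h <;> simp [h]

theorem ColumnSignEquiv.trans {m : Type*} {W Z Y : Matrix m (Fin p) ℝ} (h : ColumnSignEquiv W Z)
    (h' : ColumnSignEquiv Z Y) : ColumnSignEquiv W Y := by
  obtain ⟨s, hs, rfl⟩ := h
  obtain ⟨s', hs', rfl⟩ := h'
  refine ⟨fun j => s' j * s j, fun j => ?_, ?_⟩
  · rcases hs j with h | h <;> rcases hs' j with h' | h' <;> simp [h, h']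
  · ext i j
    simp [mul_assoc]

theorem columnSignEquiv_iff {W Z : Matrix (Fin dx ⊕ Fin dy) (Fin p) ℝ} :
    ColumnSignEquiv W Z ↔ ∃ s : Fin p → ℝ, (∀ j, s j = 1 ∨ s j = -1) ∧
      ∀ j, (columnPair W).1 j = s j • (columnPair Z).1 j ∧
        (columnPair W).2 j = s j • (columnPair Z).2 j := by
  refine exists_congr fun s => and_congr_right fun _ => ⟨?_, fun h => ?_⟩
  · rintro rfl j
    constructor <;> ext i <;>
      simp [columnPair, mul_comm]
  · ext i j
    rcases i with i | i
    · have := congrFun (h j).1 i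
      simpa [columnPair, mul_comm] using this
    · have := congrFun (h j).2 i
      simpa [columnPair, mul_comm] using this

theorem ColumnSignEquiv.ccaCost_eq {W Z : Matrix (Fin dx ⊕ Fin dy) (Fin p) ℝ}
    (h : ColumnSignEquiv W Z) (Sxy : Matrix (Fin dx) (Fin dy) ℝ) (μ : Fin p → ℝ) :
    ccaCost Sxy μ W = ccaCost Sxy μ Z := by
  obtain ⟨s, hs, h⟩ := columnSignEquiv_iff.1 h
  simp only [_root_.ccaCost_eq, pairSum, h, map_smul, _root_.smul_apply, smul_eq_mul]
  congr 1
  refine Finset.sum_congr rfl fun j _ => ?_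
  rcases hs j with h | h <;> simp [h]

theorem finite_setOf_columnSignEquiv {m : Type*} (Z : Matrix m (Fin p) ℝ) :
    {W | ColumnSignEquiv W Z}.Finite := by
  have hfin : (Set.univ.pi fun _ : Fin p => ({1, -1} : Set ℝ)).Finite :=
    Set.Finite.pi fun _ => by simp
  refine (hfin.image fun s => Z * Matrix.diagonal s).subset ?_
  rintro W ⟨s, hs, rfl⟩
  exact ⟨s, fun j _ => hs j, rfl⟩

end Columns

/-! ### Sign flip of the second block, reference pairs from the canonical correlations, and the
theorem -/

section Main

variable {dx dy p q : ℕ}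

/-- Changing the sign of the second block. -/
def flipSecond {Sxx : Matrix (Fin dx) (Fin dx) ℝ} {Syy : Matrix (Fin dy) (Fin dy) ℝ}
    (Z : prodStiefel Sxx Syy p) : prodStiefel Sxx Syy p :=
  ⟨ofColumnPair ((columnPair Z.1).1, -(columnPair Z.1).2), by
    have h := mem_prodStiefel_iff.1 Z.2
    refine mem_prodStiefel_iff.2 ⟨h.1, fun i j => ?_⟩
    have := h.2 i j
    simpa [columnPair_ofColumnPair] using this⟩

section Flip

variable {Sxx : Matrix (Fin dx) (Fin dx) ℝ} {Syy : Matrix (Fin dy) (Fin dy) ℝ}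

theorem flipSecond_flipSecond (Z : prodStiefel Sxx Syy p) : flipSecond (flipSecond Z) = Z := by
  apply Subtype.ext
  simp [flipSecond, columnPair_ofColumnPair, ofColumnPair_columnPair]

theorem continuous_flipSecond :
    Continuous (flipSecond : prodStiefel Sxx Syy p → prodStiefel Sxx Syy p) := by
  refine Continuous.subtype_mk (continuous_ofColumnPair.comp ?_) _
  have := continuous_columnPair.comp (continuous_subtype_val (p := (· ∈ prodStiefel Sxx Syy p)))
  exact (continuous_fst.comp this).prodMk (continuous_snd.comp this).neg

theorem ccaCost_flipSecond (Sxy : Matrix (Fin dx) (Fin dy) ℝ) (μ : Fin p → ℝ)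
    (Z : prodStiefel Sxx Syy p) :
    ccaCost Sxy μ (flipSecond Z).1 = -ccaCost Sxy μ Z.1 := by
  simp [ccaCost_eq, flipSecond, columnPair_ofColumnPair, pairSum]

/-- The flip is a continuous involution that negates the cost, so the classification of local
minimizers also covers local maximizers. -/
theorem IsLocalMax.flipSecond {Sxy : Matrix (Fin dx) (Fin dy) ℝ} {μ : Fin p → ℝ}
    {Z : prodStiefel Sxx Syy p}
    (h : IsLocalMax (fun Z : prodStiefel Sxx Syy p => ccaCost Sxy μ Z.1) Z) :
    IsLocalMin (fun Z : prodStiefel Sxx Syy p => ccaCost Sxy μ Z.1) (flipSecond Z) := by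
  have ht := continuous_flipSecond.tendsto (_root_.flipSecond Z)
  rw [flipSecond_flipSecond] at ht
  filter_upwards [ht.eventually h] with W hW
  simp only [ccaCost_flipSecond] at hW ⊢
  linarith

end Flip

/-- The canonical correlations come with pairs of singular vectors. -/
theorem IsCanonicalCorrelations.exists_singularPairs {Sxx : Matrix (Fin dx) (Fin dx) ℝ}
    {Sxy : Matrix (Fin dx) (Fin dy) ℝ} {Syy : Matrix (Fin dy) (Fin dy) ℝ}
    (hx : Sxx.PosDef) (hy : Syy.PosDef) {σ : Fin q → ℝ}
    (hσ : IsCanonicalCorrelations Sxx Sxy Syy σ) :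
    Antitone σ ∧ (∀ k, 0 ≤ σ k) ∧ ∃ u v, FormOrthonormal (matrixForm Sxx) u ∧
      FormOrthonormal (matrixForm Syy) v ∧
      SingularPairs (matrixForm Sxx) (matrixForm Syy) (matrixForm Sxy) σ u v := by
  obtain ⟨U, V, hUV, hmax⟩ := hσ
  have h := singularPairs_of_diagonal_maximal (A := matrixForm Sxy) (u₀ := U.transpose)
    (v₀ := V.transpose) (σ := σ) (matrixForm_comm hx)
    (matrixForm_self_pos hx) (matrixForm_comm hy) (matrixForm_self_pos hy)
    (mem_genStiefel_iff.1 hUV.memU) (mem_genStiefel_iff.1 hUV.memV)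
    (fun i j => by rw [matrixForm_columns, hUV.diag, Matrix.diagonal_apply])
    (fun d u v hd hu hv huv => by
      have h1 := hmax d (Matrix.of u).transpose (Matrix.of v).transpose
        ⟨hd, mem_genStiefel_iff.2 hu, mem_genStiefel_iff.2 hv, by
          ext i j
          rw [← matrixForm_columns, Matrix.diagonal_apply]
          exact huv i j⟩
      simp only [Matrix.trace, Matrix.diag_apply, ← matrixForm_columns] at h1
      exact h1)
  exact ⟨hUV.antitone, h.2, _, _, mem_genStiefel_iff.1 hUV.memU, mem_genStiefel_iff.1 hUV.memV,
    h.1⟩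

end Main

theorem mainTheorem8 {n dx dy p q : ℕ}
    (X : Matrix (Fin n) (Fin dx) ℝ) (Y : Matrix (Fin n) (Fin dy) ℝ)
    (lamx lamy : ℝ) (hlamx : 0 ≤ lamx) (hlamy : 0 ≤ lamy)
    (Sxx : Matrix (Fin dx) (Fin dx) ℝ) (hSxx : Sxx = regGram X lamx)
    (Syy : Matrix (Fin dy) (Fin dy) ℝ) (hSyy : Syy = regGram Y lamy)
    (Sxy : Matrix (Fin dx) (Fin dy) ℝ) (hSxy : Sxy = X.transpose * Y)
    (hSPD : (Matrix.fromBlocks Sxx 0 0 Syy).PosDef)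
    (Mx : Matrix (Fin dx) (Fin dx) ℝ) (hMx : Mx.PosDef)
    (My : Matrix (Fin dy) (Fin dy) ℝ) (hMy : My.PosDef)
    (hq : q = min Sxx.rank Syy.rank)
    (σ : Fin q → ℝ) (hσ : IsCanonicalCorrelations Sxx Sxy Syy σ)
    (hσ_distinct : Function.Injective σ)
    (hp : 1 ≤ p) (hpq : p ≤ q) (hedge : p = q → dx ≠ dy ∧ ∀ i, 0 < σ i)
    (μ : Fin p → ℝ) (hμ_anti : StrictAnti μ) (hμ_pos : ∀ j, 0 < μ j)
    (f : prodStiefel Sxx Syy p → ℝ) (hf : f = fun Z => ccaCost Sxy μ Z.1)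
    (Crit : prodStiefel Sxx Syy p → Prop)
    (hCrit : Crit = IsRiemannianCritical Sxx Syy Mx My (ccaCost Sxy μ)) :
    (∃ Zs : prodStiefel Sxx Syy p, ∀ Z, f Zs ≤ f Z) ∧
    ∀ Zs : prodStiefel Sxx Syy p, (∀ Z, f Zs ≤ f Z) →
      Crit Zs ∧
      -- the local minimizers are the sign changes of the global one, and they are all strict
      (∀ Z, IsLocalMin f Z ↔ ColumnSignEquiv Z.1 Zs.1) ∧
      (∀ Z, IsStrictLocalMinimizer f Z ↔ ColumnSignEquiv Z.1 Zs.1) ∧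
      -- every other critical point is a saddle point or a global maximizer
      (∀ Z, Crit Z → ¬ ColumnSignEquiv Z.1 Zs.1 →
        (¬ IsLocalMin f Z ∧ ¬ IsLocalMax f Z) ∨ (∀ W, f W ≤ f Z)) ∧
      -- stability under descent algorithms
      (∀ F : prodStiefel Sxx Syy p → prodStiefel Sxx Syy p,
        IsDescentMapping f F →
        (∀ Z W, MapClusterPt W atTop (fun k : ℕ => F^[k] Z) → Crit W) →
        (∀ W, IsLocalMin f W → Tendsto (fun Z => (F Z).1 - Z.1) (𝓝 W) (𝓝 0)) →
        ∀ Z, Crit Z →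
          (IsAsymptoticallyStablePoint F Z ↔ ColumnSignEquiv Z.1 Zs.1) ∧
          (¬ ColumnSignEquiv Z.1 Zs.1 → ¬ IsStablePoint F Z)) := by
  subst hf hCrit
  have hx : Sxx.PosDef :=
    hSPD.submatrix (Sum.inl_injective (α := Fin dx) (β := Fin dy))
  have hy : Syy.PosDef :=
    hSPD.submatrix (Sum.inr_injective (α := Fin dx) (β := Fin dy))
  rw [Matrix.rank_of_isUnit _ hx.isUnit, Matrix.rank_of_isUnit _ hy.isUnit, Fintype.card_fin,
    Fintype.card_fin] at hq
  -- Positive definite blocks have full rank, so `q = min dx dy` and the reference vectors span the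
  -- smaller space.
  have hq' : q = Module.finrank ℝ (Fin dx → ℝ) ∨ q = Module.finrank ℝ (Fin dy → ℝ) := by
    simp only [Module.finrank_fin_fun]
    omega
  -- Without a spare direction `p = q = dx = dy`, which `hedge` excludes.
  have hpd : p < Module.finrank ℝ (Fin dx → ℝ) ∨ p < Module.finrank ℝ (Fin dy → ℝ) := by
    simp only [Module.finrank_fin_fun]
    by_contra! hne
    exact (hedge (by omega)).1 (by omega)
  obtain ⟨hσa, hσ0, u₀, v₀, hu₀, hv₀, h₀⟩ := hσ.exists_singularPairs hx hy
  have hσs : StrictAnti σ := hσa.strictAnti_of_injective hσ_distinct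
  have hBc := matrixForm_comm hx
  have hBp := matrixForm_self_pos hx
  have hCc := matrixForm_comm hy
  have hCp := matrixForm_self_pos hy
  -- The leading `p` reference pairs; this point shows that the space is nonempty and represents the
  -- sign orbit of all local minimizers.
  let Z₀ : Matrix (Fin dx ⊕ Fin dy) (Fin p) ℝ :=
    ofColumnPair (fun j => u₀ (Fin.castLE hpq j), fun j => v₀ (Fin.castLE hpq j))
  have hZ₀ : Z₀ ∈ prodStiefel Sxx Syy p := mem_prodStiefel_iff.2
    ⟨fun i j => (hu₀ (Fin.castLE hpq i) (Fin.castLE hpq j)).trans (by simp),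
      fun i j => (hv₀ (Fin.castLE hpq i) (Fin.castLE hpq j)).trans (by simp)⟩
  have hcont : Continuous fun Z : prodStiefel Sxx Syy p => ccaCost Sxy μ Z.1 := by
    simp only [ccaCost_eq]
    exact ((continuous_pairSum _ μ).comp
      (continuous_columnPair.comp continuous_subtype_val)).neg
  have : CompactSpace (prodStiefel Sxx Syy p) :=
    isCompact_iff_compactSpace.1 (isCompact_prodStiefel hx hy p)
  have hloc : ∀ Z : prodStiefel Sxx Syy p,
      IsLocalMin (fun Z : prodStiefel Sxx Syy p => ccaCost Sxy μ Z.1) Z →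
        ColumnSignEquiv Z.1 Z₀ := by
    intro Z hZ
    have hZ' := mem_prodStiefel_iff.1 Z.2
    exact columnSignEquiv_iff.2 (exists_sign_of_isLocalMaxOn hBc hBp hCc hCp hu₀ hv₀ h₀ hσs hσ0
      hq' hpq hpd (fun h => (hedge h).2) hμ_pos hμ_anti hZ'.1 hZ'.2
      (isLocalMaxOn_pairSum_of_isLocalMin hZ))
  obtain ⟨T, hT, hcritT⟩ : ∃ T : Set ℝ, T.Finite ∧ ∀ Z : prodStiefel Sxx Syy p,
      IsRiemannianCritical Sxx Syy Mx My (ccaCost Sxy μ) Z → ccaCost Sxy μ Z.1 ∈ T := by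
    refine ⟨_, (finite_pairSum_singularPairs hBc hBp hCc hCp hu₀ hv₀ h₀ hσ_distinct hσ0 hq'
      μ).image Neg.neg, fun Z hZ => ?_⟩
    obtain ⟨θ, hθ⟩ := (isRiemannianCritical_iff hx hy hμ_pos hμ_anti.injective Z).1 hZ
    have hZ' := mem_prodStiefel_iff.1 Z.2
    exact ⟨_, ⟨_, _, θ, hZ'.1, hZ'.2, hθ, rfl⟩, (ccaCost_eq _ _ _).symm⟩
  have hex : ∃ Zs : prodStiefel Sxx Syy p, ∀ Z : prodStiefel Sxx Syy p,
      ccaCost Sxy μ Zs.1 ≤ ccaCost Sxy μ Z.1 := by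
    obtain ⟨Zs, -, h⟩ := isCompact_univ.exists_isMinOn ⟨⟨Z₀, hZ₀⟩, Set.mem_univ _⟩
      hcont.continuousOn
    exact ⟨Zs, fun Z => h (Set.mem_univ Z)⟩
  refine ⟨hex, fun Zs hZs => ?_⟩
  simp only at hZs
  have hZs₀ : ColumnSignEquiv Zs.1 Z₀ := hloc Zs (.of_forall hZs)
  have hglob : ∀ {Z : prodStiefel Sxx Syy p}, ColumnSignEquiv Z.1 Zs.1 →
      ∀ W : prodStiefel Sxx Syy p, ccaCost Sxy μ Z.1 ≤ ccaCost Sxy μ W.1 := fun h W => by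
    rw [h.ccaCost_eq]
    exact hZs W
  have hequiv : ∀ Z : prodStiefel Sxx Syy p,
      IsLocalMin (fun Z : prodStiefel Sxx Syy p => ccaCost Sxy μ Z.1) Z →
        ColumnSignEquiv Z.1 Zs.1 := fun Z hZ => (hloc Z hZ).trans hZs₀.symm
  have hstrict : ∀ Z : prodStiefel Sxx Syy p, ColumnSignEquiv Z.1 Zs.1 →
      IsStrictLocalMinimizer (fun Z : prodStiefel Sxx Syy p => ccaCost Sxy μ Z.1) Z := by
    intro Z hZ
    refine isStrictLocalMinimizer_of_finite (hglob hZ) ?_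
    -- Points with the minimal value are local minimizers, hence lie in one finite sign orbit.
    refine ((finite_setOf_columnSignEquiv Zs.1).preimage
      Subtype.val_injective.injOn).subset fun W hW => ?_
    exact hequiv W (.of_forall fun Y => (le_of_eq hW).trans (hglob hZ Y))
  refine ⟨?_, fun Z => ⟨hequiv Z, fun h => (hstrict Z h).isLocalMin⟩,
    fun Z => ⟨fun h => hequiv Z h.isLocalMin, hstrict Z⟩, fun Z _ hne => ?_, ?_⟩
  · have hZ' := mem_prodStiefel_iff.1 Zs.2
    exact (isRiemannianCritical_iff hx hy hμ_pos hμ_anti.injective Zs).2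
      ⟨_, (StationaryPair.of_isLocalMaxOn hBc hCc hZ'.1 hZ'.2
        (isLocalMaxOn_pairSum_of_isLocalMin (.of_forall hZs))).singularPairs hBc hBp hCc hCp
        hZ'.1 hZ'.2 hμ_pos hμ_anti.injective⟩
  · by_cases hmax : IsLocalMax (fun Z : prodStiefel Sxx Syy p => ccaCost Sxy μ Z.1) Z
    · refine .inr fun W => ?_
      -- The flipped local maximizer is a global minimizer; comparing it with the flip of `W` and
      -- undoing the signs gives global maximality.
      have h := hglob (hequiv _ hmax.flipSecond) (flipSecond W)
      simp only [ccaCost_flipSecond] at h ⊢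
      linarith
    · exact .inl ⟨fun h => hne (hequiv Z h), hmax⟩
  · intro F hF hcl hstep Z _
    have hclT : ∀ Y W, MapClusterPt W atTop (fun k : ℕ => F^[k] Y) → ccaCost Sxy μ W.1 ∈ T :=
      fun Y W h => hcritT W (hcl Y W h)
    have hunst : ¬ ColumnSignEquiv Z.1 Zs.1 → ¬ IsStablePoint F Z := fun hne =>
      not_isStablePoint_of_not_isLocalMin hcont (fun h => hne (hequiv Z h)) hF hT hclT
    refine ⟨⟨fun h => by_contra fun hne => hunst hne h.1, fun h => ?_⟩, hunst⟩
    have hs := hstrict Z h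
    refine hs.isAsymptoticallyStablePoint hcont hF (tendsto_subtype_rng.2 ?_) hT hclT
    -- Continuity of `F` at `Z` comes from writing `F Y = (F Y - Y) + Y`, where the step tends to
    -- `0`.
    simpa using (hstep Z hs.isLocalMin).add (continuous_subtype_val.tendsto Z)
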